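/- Let $G$ be a finite generalized dihedral group generated by $A$ and $t$: $A$ is an abelian subgroup of index $2$ in $G$, and $t\in G\setminus A$ is an involution with $tat=a^{-1}$ for all $a\in A$. Let $S\subseteq G\setminus\{e\}$ be inverse-closed with $|S|=4$ and $t\in S$, and let $\Gamma=\mathrm{Cay}(G,S)$ be the graph with vertex set $G$ in which $x,y$ are adjacent if and only if $x^{-1}y\in S$. Assume that $\Gamma$ is connected and admits a perfect code, i.e. a set $D\subseteq G$ such that every vertex of $\Gamma$ is equal or adjacent to exactly one element of $D$. For $s_0,s_1,s_2\in A$ let $n$ be the order of $s_0$, let $m$ be the least positive integer with $s_1^m\in\langle s_0\rangle$, and let $l$ be the least positive integer with $s_2^l\in\langle s_0,s_1\rangle$. For an integer $k$ put $\sigma(k)=(1-(-1)^k)/2$. (1) Suppose that $S=\{s_1,s_1^{-1},t,ts_0\}$ with $s_0,s_1\in A$, that $5\mid n$, and that, for at least one sign, $s_1^m=s_0^{5u/2\pm m}$ for some $u\in\{0,2,4,\ldots,2(n/5-1)\}$. Then the perfect codes of $\Gamma$ containing $t$ are exactly the sets $$\bigcup_{k=0}^{m-1}\ \bigcup_{u\in\{0,2,\ldots,2(n/5-1)\}}\left\{s_0^{5u/2+\epsilon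 k}s_1^{k}t,\ s_0^{3+5u/2+\epsilon k}s_1^{k}\right\},$$ where $\epsilon$ runs over those elements of $\{1,-1\}$ for which $s_1^m=s_0^{5u/2-\epsilon m}$ for some $u\in\{0,2,\ldots,2(n/5-1)\}$. (2) Call $(v,a,b)$ suitable if $v\in\{2,3,4\}$, $\{a,b\}=\{2+\sigma(v),v-\sigma(v)-1\}$, and there are $\alpha_1,\alpha_2\in\{0,1,\ldots,n/5-1\}$ and $j\in\{0,1,\ldots,m-1\}$ with $s_1^m=s_0^{5\alpha_1-am}$ and $s_2^l=s_0^{5\alpha_2-bl+aj}s_1^j$. Suppose that $S=\{t,ts_0,ts_1,ts_2\}$ with $s_0,s_1,s_2\in A$, that $5\mid n$, and that at least one suitable triple exists. Then the perfect codes of $\Gamma$ containing $t$ are exactly the sets $$\bigcup_{\alpha'=0}^{n/5-1}\ \bigcup_{j'=0}^{m-1}\ \bigcup_{k'=0}^{l-1}\left(\left\{s_0^{5\alpha'+aj'+bk'}s_1^{j'}s_2^{k'}t\right\}\cup\left\{s_0^{5\alpha'+aj'+bk'+v}s_1^{j'}s_2^{k'}\right\}\right),$$ where $(v,a,b)$ runs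 over the suitable triples. -/

import Mathlib

/-- `G` is the generalized dihedral group generated by its abelian subgroup `A` of index `2`
and the involution `t ∉ A`, which inverts every element of `A`. -/
structure IsGeneralizedDihedral {G : Type*} [Group G] (A : Subgroup G) (t : G) : Prop where
  index_two : A.index = 2
  comm : ∀ x ∈ A, ∀ y ∈ A, x * y = y * x
  order_two : orderOf t = 2
  notMem : t ∉ A
  conj : ∀ x ∈ A, t * x * t = x⁻¹

/-- `S` is an inverse-closed set of four non-identity elements whose Cayley graph is connected.
In `SimpleGraph.mulCayley S` the neighbours of `x` are the elements `x * s` with `s ∈ S`. -/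
structure IsQuarticConnectionSet {G : Type*} [Group G] (S : Set G) : Prop where
  one_notMem : (1 : G) ∉ S
  inv_mem : ∀ x ∈ S, x⁻¹ ∈ S
  card_four : S.ncard = 4
  connected : (SimpleGraph.mulCayley S).Connected

/-- Every vertex is dominated by (equal or adjacent to) exactly one vertex of `D`. -/
def IsPerfectCode {V : Type*} (Γ : SimpleGraph V) (D : Set V) : Prop :=
  ∀ x : V, ∃! d : V, d ∈ D ∧ (d = x ∨ Γ.Adj d x)

/-- `5 ∣ o(s₀)` and `s₁ ^ m = s₀ ^ (5 w + δ m)` for some `0 ≤ w ≤ o(s₀) / 5 - 1`. -/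
def ConditionOne {G : Type*} [Group G] (s₀ s₁ : G) (m : ℕ) (δ : ℤ) : Prop :=
  5 ∣ orderOf s₀ ∧ ∃ w < orderOf s₀ / 5, s₁ ^ m = s₀ ^ (5 * (w : ℤ) + δ * (m : ℤ))

/-- The union of the pairs `{s₀ ^ (5 w + ε k) s₁ ^ k t, s₀ ^ (3 + 5 w + ε k) s₁ ^ k}` over
`0 ≤ k ≤ m - 1` and `0 ≤ w ≤ o(s₀) / 5 - 1`. -/
def codeOne {G : Type*} [Group G] (t s₀ s₁ : G) (m : ℕ) (ε : ℤ) : Set G :=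
  ⋃ k ∈ Finset.range m, ⋃ w ∈ Finset.range (orderOf s₀ / 5),
    {s₀ ^ (5 * (w : ℤ) + ε * (k : ℤ)) * s₁ ^ k * t,
      s₀ ^ (3 + 5 * (w : ℤ) + ε * (k : ℤ)) * s₁ ^ k}

/-- `σ(k) = (1 - (-1) ^ k) / 2`, that is, `0` for even `k` and `1` for odd `k`. -/
def parity (k : ℕ) : ℤ := (1 - (-1) ^ k) / 2

/-- `v ∈ {2, 3, 4}` and `{a, b} = {2 + σ(v), v - σ(v) - 1}`. -/
def AdmissibleTriple (v : ℕ) (a b : ℤ) : Prop :=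
  v ∈ ({2, 3, 4} : Set ℕ) ∧
    ({a, b} : Set ℤ) = {2 + parity v, (v : ℤ) - parity v - 1}

/-- `5 ∣ o(s₀)`, `s₁ ^ m = s₀ ^ (5 α₁ - a m)` and `s₂ ^ l = s₀ ^ (5 α₂ - b l + a j) s₁ ^ j` for
some `0 ≤ α₁, α₂ ≤ o(s₀) / 5 - 1` and `0 ≤ j ≤ m - 1`. -/
def ConditionTwo {G : Type*} [Group G] (s₀ s₁ s₂ : G) (m l : ℕ) (a b : ℤ) : Prop :=
  5 ∣ orderOf s₀ ∧
    ∃ α₁ < orderOf s₀ / 5, ∃ α₂ < orderOf s₀ / 5, ∃ j < m,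
      s₁ ^ m = s₀ ^ (5 * (α₁ : ℤ) - a * (m : ℤ)) ∧
      s₂ ^ l = s₀ ^ (5 * (α₂ : ℤ) - b * (l : ℤ) + a * (j : ℤ)) * s₁ ^ j

/-- The union of `{s₀ ^ (5 α + a j + b k) s₁ ^ j s₂ ^ k t}` and
`{s₀ ^ (5 α + a j + b k + v) s₁ ^ j s₂ ^ k}` over `0 ≤ α ≤ o(s₀) / 5 - 1`, `0 ≤ j ≤ m - 1`,
`0 ≤ k ≤ l - 1`. -/
def codeTwo {G : Type*} [Group G] (t s₀ s₁ s₂ : G) (m l v : ℕ) (a b : ℤ) : Set G :=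
  ⋃ α ∈ Finset.range (orderOf s₀ / 5), ⋃ j ∈ Finset.range m, ⋃ k ∈ Finset.range l,
    ({s₀ ^ (5 * (α : ℤ) + a * (j : ℤ) + b * (k : ℤ)) * s₁ ^ j * s₂ ^ k * t} ∪
      {s₀ ^ (5 * (α : ℤ) + a * (j : ℤ) + b * (k : ℤ) + (v : ℤ)) * s₁ ^ j * s₂ ^ k})

/-! Writing elements of `A` as words in the `sᵢ` makes `Γ` a quotient of an infinite graph: the
square grid in case (1), and in case (2) the bipartite graph on two copies of `ℤ³` in which `x` is
joined to `x`, `x + e₁`, `x + e₂`, `x + e₃`. Connectedness says that these words, with or without a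
factor `t`, exhaust `G`. A set is a perfect code of `Γ` exactly when its preimage is one upstairs,
so it suffices to classify codes upstairs and to see which of them descend.

Upstairs every code through the base point is a union of cosets of an index-5 sublattice. In the
grid, a codeword forces four others at knight moves of one chirality, and neighbouring codewords
share that chirality (`IsGridCode.exists_linear`). In the bipartite graph, the codewords at distance
three from a codeword induce a cyclic order on the four directions (`exists_cyclic_order`). The
order passes on to some of those codewords (`propagate`), which yields enough periods to span the
sublattice (`IsBipartiteCode.exists_linear`). The resulting linear forms mod 5 give codes, and a
code contained in another equals it.

A code given by a linear form descends exactly when the form vanishes mod 5 on the relations among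
the `sᵢ` (`RelationsVanish`). Tested on a triangular basis of relations, this is the stated
arithmetic condition (`conditionTwo_iff_relationsVanish`), and reduced exponents turn the code into
the explicit union (`mem_codeTwo_iff`). -/

/-! ### Bipartite codes: local structure and periods. -/

/-- A perfect code of the bipartite graph on two copies of `M` in which `x` in the first copy is
adjacent to the four elements `x + e i` of the second copy; `P` and `Q` are the two parts of the
code. -/
structure IsBipartiteCode {M : Type*} [AddCommGroup M] (e : Fin 4 → M) (P Q : M → Prop) :
    Prop where
  cover_left : ∀ x, P x ∨ ∃ i, Q (x + e i)
  cover_right : ∀ x, Q x ∨ ∃ i, P (x - e i)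
  unique_left : ∀ x i j, Q (x + e i) → Q (x + e j) → i = j
  unique_right : ∀ x i j, P (x - e i) → P (x - e j) → i = j
  disjoint : ∀ x i, P x → ¬ Q (x + e i)

/-- The eight codewords at distance three from `x`, arranged along the cyclic order of `f`. -/
def IsCyclicallySurrounded {M : Type*} [AddCommGroup M] (f : Fin 4 → M) (Q : M → Prop) (x : M) :
    Prop :=
  ∀ i, Q (x + f (i + 1) + f (i + 1) - f i) ∧ Q (x + f (i + 2) + f (i + 3) - f i)

-- A permutation of four points without fixed points or 2-cycles is a 4-cycle; `σ` runs along it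
-- from `0`.
set_option maxRecDepth 100000 in
lemma exists_cyclic_enumeration (g : Fin 4 → Fin 4) (hinj : Function.Injective g)
    (h1 : ∀ j, g j ≠ j) (h2 : ∀ j, g (g j) ≠ j) :
    ∃ σ : Fin 4 → Fin 4, Function.Injective σ ∧ σ 0 = 0 ∧ ∀ i, g (σ i) = σ (i + 1) := by
  refine ⟨![0, g 0, g (g 0), g (g (g 0))], ?_, rfl, ?_⟩
  all_goals
    revert g
    decide

/-- Here `B i k j` stands for a codeword at `x + e i + e k - e j`. For each `j`, the map `i ↦ k`
pairs up the three indices other than `j`; the fixed index of this pairing is the successor of `j`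
in the cyclic order. -/
lemma exists_cyclic_order (B : Fin 4 → Fin 4 → Fin 4 → Prop)
    (symm : ∀ i k j, B i k j → B k i j)
    (cover : ∀ i j, i ≠ j → ∃ k ≠ j, B i k j)
    (unique_mid : ∀ i k k' j, B i k j → B i k' j → k = k')
    (unique_right : ∀ i k j j', B i k j → B i k j' → j = j') :
    ∃ σ : Fin 4 → Fin 4, Function.Injective σ ∧ σ 0 = 0 ∧
      ∀ i, B (σ (i + 1)) (σ (i + 1)) (σ i) ∧ B (σ (i + 2)) (σ (i + 3)) (σ i) := by
  -- By symmetry and uniqueness `i ↦ k` is an involution on the three indices `≠ j`, so it fixes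
  -- one.
  have single : ∀ j, ∃ l, l ≠ j ∧ B l l j := by
    intro j
    obtain ⟨a, b, c, haj, hbj, hcj, hab, hac, hbc, hall⟩ :
        ∃ a b c : Fin 4, a ≠ j ∧ b ≠ j ∧ c ≠ j ∧ a ≠ b ∧ a ≠ c ∧ b ≠ c ∧
          ∀ k, k = j ∨ k = a ∨ k = b ∨ k = c := by
      revert j; decide
    obtain ⟨k, hk, hB⟩ := cover a j haj
    obtain ⟨k', hk', hB'⟩ := cover b j hbj
    obtain ⟨k'', hk'', hB''⟩ := cover c j hcj
    grind
  choose g hg hB using single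
  have hinj : Function.Injective g := fun i j h => unique_right (g i) (g i) i j (hB i) (h ▸ hB j)
  have hsurj := Finite.surjective_of_injective hinj
  -- Only one index is fixed, so the remaining two are exchanged.
  have double : ∀ j a b, a ≠ j → a ≠ g j → b ≠ j → b ≠ g j → a ≠ b → B a b j := by
    intro j a b haj hag hbj hbg hab
    obtain ⟨k, hk, hBk⟩ := cover a j haj
    have hka : k ≠ a := by
      rintro rfl
      obtain ⟨j', rfl⟩ := hsurj k
      exact hag (congrArg g (unique_right _ _ _ _ (hB j') hBk))
    have hkg : k ≠ g j := by
      rintro rfl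
      exact hag (unique_mid _ _ _ _ (symm _ _ _ hBk) (hB j))
    have : k = b := by
      have := hg j
      generalize g j = z at *
      clear * - haj hag hbj hbg hab hk hka hkg this
      omega
    exact this ▸ hBk
  -- If `g` exchanged `j` and `g j`, the other two indices `a, b` would satisfy both `B a b j` and
  -- `B a b (g j)`.
  obtain ⟨σ, hσ, h0, hs⟩ := exists_cyclic_enumeration g hinj hg (by
    intro j hj
    obtain ⟨a, b, h⟩ : ∃ a b : Fin 4, a ≠ j ∧ a ≠ g j ∧ b ≠ j ∧ b ≠ g j ∧ a ≠ b := by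
      generalize g j = z
      clear * -
      revert j z; decide
    obtain ⟨h1, h2, h3, h4, h5⟩ := h
    have e1 := double j a b h1 h2 h3 h4 h5
    have e2 := double (g j) a b h2 (by rwa [hj]) h4 (by rwa [hj]) h5
    exact hg j (unique_right _ _ _ _ e2 e1))
  refine ⟨σ, hσ, h0, fun i => ⟨hs i ▸ hB (σ i), ?_⟩⟩
  apply double
  all_goals
    try rw [hs]
    apply hσ.ne
    revert i
    decide

namespace IsBipartiteCode

variable {M : Type*} [AddCommGroup M] {e f : Fin 4 → M} {P Q : M → Prop}

lemma neg (h : IsBipartiteCode e P Q) : IsBipartiteCode (fun i => -e i) Q P where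
  cover_left x := by simpa [sub_eq_add_neg] using h.cover_right x
  cover_right x := by simpa using h.cover_left x
  unique_left x i j := by simpa [sub_eq_add_neg] using h.unique_right x i j
  unique_right x i j := by simpa using h.unique_left x i j
  disjoint x i hQ hP := h.disjoint _ i hP (by simpa using hQ)

lemma comp (h : IsBipartiteCode e P Q) {σ : Fin 4 → Fin 4} (hσ : Function.Injective σ) :
    IsBipartiteCode (fun i => e (σ i)) P Q where
  cover_left x := by
    exact (h.cover_left x).imp_right fun ⟨i, hi⟩ =>
      (Finite.surjective_of_injective hσ i).imp fun j hj => by rwa [hj]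
  cover_right x := by
    exact (h.cover_right x).imp_right fun ⟨i, hi⟩ =>
      (Finite.surjective_of_injective hσ i).imp fun j hj => by rwa [hj]
  unique_left x i j h1 h2 := hσ (h.unique_left x _ _ h1 h2)
  unique_right x i j h1 h2 := hσ (h.unique_right x _ _ h1 h2)
  disjoint x i := h.disjoint x _

/-- Both codewords are neighbours of `y - e j`: one is that point plus `e j`, the other that point
plus `e i`. -/
lemma unique_add (h : IsBipartiteCode e P Q) {y z : M} {i j : Fin 4} (hy : Q y) (hz : Q z)
    (hyz : y + e i = z + e j) : i = j := by
  refine h.unique_left (y - e j) i j ?_ (by simpa using hy)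
  rwa [show y - e j + e i = z by rw [sub_add_eq_add_sub, hyz, add_sub_cancel_right]]

/-- For `i ≠ j` the vertex `x + e i - e j` shares the neighbour `x + e i` with the codeword `x`. It
is therefore not in the code, and a codeword `x + e i - e j + e k` must dominate it, with `k ≠ j`.
-/
lemma exists_isCyclicallySurrounded (h : IsBipartiteCode e P Q) {x : M} (hx : P x) :
    ∃ σ : Fin 4 → Fin 4, Function.Injective σ ∧ σ 0 = 0 ∧
      IsCyclicallySurrounded (fun i => e (σ i)) Q x := by
  refine exists_cyclic_order (fun i k j => Q (x + e i + e k - e j)) ?_ ?_ ?_ ?_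
  · intro i k j hQ
    rwa [add_right_comm]
  · intro i j hij
    obtain hP | ⟨k, hk⟩ := h.cover_left (x + e i - e j)
    · refine absurd (h.unique_right (x + e i) i j (by simpa using hx) hP) hij
    · refine ⟨k, ?_, by convert hk using 1; abel⟩
      rintro rfl
      exact h.disjoint x i hx (by simpa using hk)
  · intro i k k' j h1 h2
    exact (h.unique_add h1 h2 (by abel : _ + e k' = _ + e k)).symm
  · intro i k j j' h1 h2
    exact h.unique_add h1 h2 (by abel)

/-- The codeword `y` has a cyclic order of its own. That `x` is one of the codewords around `y`
fixes its beginning, and only a transposition of `2` and `3` remains to be excluded. -/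
lemma propagate (h : IsBipartiteCode f P Q) {x y : M}
    (hloc : IsCyclicallySurrounded f Q x) (hx : P x) (hy : Q y)
    (hyx : y = x + f 1 + f 1 - f 0 ∨ y = x + f 2 + f 3 - f 0) :
    IsCyclicallySurrounded (fun i => -f i) P y := by
  obtain ⟨σ, hσ, h0, hs⟩ := h.neg.exists_isCyclicallySurrounded hy
  -- This point is adjacent to the codeword `x + f 1 + f 2 - f 3`.
  have key : ¬ P (x + f 1 + f 2 - f 3 - f 0) := fun hP =>
    h.disjoint _ 0 hP (by simpa using (hloc 3).2)
  have conflict : ∀ a b c : Fin 4, P (y - f a - f b + f 0) → P (y - f a - f c + f 0) → b = c :=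
    fun a b c h1 h2 => (h.neg.unique_add h1 h2 (by abel : _ + -f c = _ + -f b)).symm
  have s0 : P (y - f (σ 1) - f (σ 1) + f 0) := by simpa [h0, sub_eq_add_neg] using (hs 0).1
  have d0 : P (y - f (σ 2) - f (σ 3) + f 0) := by simpa [h0, sub_eq_add_neg] using (hs 0).2
  have d0' : P (y - f (σ 3) - f (σ 2) + f 0) := by convert d0 using 1; abel
  have s1 : P (y - f (σ 2) - f (σ 2) + f (σ 1)) := by simpa [sub_eq_add_neg] using (hs 1).1
  have d3 : P (y - f (σ 1) - f (σ 2) + f (σ 3)) := by simpa [sub_eq_add_neg] using (hs 3).2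
  have hσ1 : σ 1 = 1 := by
    have hne : ∀ i j, i ≠ j → σ i ≠ σ j := fun i j hij => hσ.ne hij
    have h10 := hne 1 0 (by decide)
    have h12 := hne 1 2 (by decide)
    have h13 := hne 1 3 (by decide)
    have h20 := hne 2 0 (by decide)
    have h30 := hne 3 0 (by decide)
    have h23 := hne 2 3 (by decide)
    rcases hyx with hyx | hyx
    · have hP : P (y - f 1 - f 1 + f 0) := by convert hx using 1; rw [hyx]; abel
      by_contra hne1
      have : σ 2 = 1 ∨ σ 3 = 1 := by
        rw [h0] at *
        generalize σ 1 = a at *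
        generalize σ 2 = b at *
        generalize σ 3 = c at *
        clear * - h10 h12 h13 h20 h30 h23 hne1
        revert a b c
        decide
      rcases this with h2 | h3
      · rw [h2] at d0
        exact h23 (h2.trans (conflict _ _ _ hP d0))
      · rw [h3] at d0'
        exact h23 ((conflict _ _ _ hP d0').symm.trans h3.symm)
    · have hP : P (y - f 2 - f 3 + f 0) := by convert hx using 1; rw [hyx]; abel
      have hP' : P (y - f 3 - f 2 + f 0) := by convert hx using 1; rw [hyx]; abel
      have e2 : σ 1 ≠ 2 := fun h2 => by
        rw [h2] at s0
        exact absurd (conflict _ _ _ s0 hP) (by decide)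
      have e3 : σ 1 ≠ 3 := fun h3 => by
        rw [h3] at s0
        exact absurd (conflict _ _ _ s0 hP') (by decide)
      rw [h0] at h10
      generalize σ 1 = a at *
      clear * - h10 e2 e3
      revert a
      decide
  have hσ2 : σ 2 = 2 ∧ σ 3 = 3 ∨ σ 2 = 3 ∧ σ 3 = 2 := by
    have h21 := hσ.ne (show (2 : Fin 4) ≠ 1 by decide)
    have h31 := hσ.ne (show (3 : Fin 4) ≠ 1 by decide)
    have h20 := hσ.ne (show (2 : Fin 4) ≠ 0 by decide)
    have h30 := hσ.ne (show (3 : Fin 4) ≠ 0 by decide)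
    have h23 := hσ.ne (show (2 : Fin 4) ≠ 3 by decide)
    rw [hσ1] at h21 h31
    rw [h0] at h20 h30
    generalize σ 2 = b at *
    generalize σ 3 = c at *
    clear * - h21 h31 h20 h30 h23
    revert b c
    decide
  rcases hσ2 with ⟨h2, h3⟩ | ⟨h2, h3⟩
  · have : σ = id := by
      funext i
      fin_cases i <;> assumption
    simpa [this] using hs
  · exfalso
    rw [hσ1, h2] at s1 d3
    rw [h3] at d3
    apply key
    rcases hyx with rfl | rfl
    · convert d3 using 1; abel
    · convert s1 using 1; abel

end IsBipartiteCode

lemma IsCyclicallySurrounded.rotate {M : Type*} [AddCommGroup M] {f : Fin 4 → M} {Q : M → Prop}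
    {x : M} (h : IsCyclicallySurrounded f Q x) (c : Fin 4) :
    IsCyclicallySurrounded (fun i => f (i + c)) Q x := by
  intro i
  simpa only [add_right_comm i c] using h (i + c)

namespace IsBipartiteCode

variable {M : Type*} [AddCommGroup M] {e f : Fin 4 → M} {P Q : M → Prop}

/-- Two propagations, `x → x + 2 f 1 - f 0 → x + 2 f 1 - f 2 - f 3`, return to the first copy; going
through the other codeword gives the opposite translation. -/
lemma translate_zero (h : IsBipartiteCode f P Q) {x : M} (hx : P x)
    (hloc : IsCyclicallySurrounded f Q x) :
    (P (x + (f 1 + f 1 - f 2 - f 3)) ∧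
      IsCyclicallySurrounded f Q (x + (f 1 + f 1 - f 2 - f 3))) ∧
    (P (x - (f 1 + f 1 - f 2 - f 3)) ∧
      IsCyclicallySurrounded f Q (x - (f 1 + f 1 - f 2 - f 3))) := by
  have q1 : Q (x + f 1 + f 1 - f 0) := (hloc 0).1
  have q2 : Q (x + f 2 + f 3 - f 0) := (hloc 0).2
  have l1 := h.propagate hloc hx q1 (.inl rfl)
  have l2 := h.propagate hloc hx q2 (.inr rfl)
  have p1 : P (x + (f 1 + f 1 - f 2 - f 3)) := by
    convert (l1 0).2 using 1
    simp only [zero_add]; abel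
  have p2 : P (x - (f 1 + f 1 - f 2 - f 3)) := by
    convert (l2 0).1 using 1
    simp only [zero_add]; abel
  refine ⟨⟨p1, ?_⟩, ⟨p2, ?_⟩⟩
  · simpa using h.neg.propagate l1 q1 p1 (.inr (by abel))
  · simpa using h.neg.propagate l2 q2 p2 (.inl (by abel))

lemma translate (h : IsBipartiteCode f P Q) (c : Fin 4) {x : M} (hx : P x)
    (hloc : IsCyclicallySurrounded f Q x) :
    (P (x + (f (1 + c) + f (1 + c) - f (2 + c) - f (3 + c))) ∧
      IsCyclicallySurrounded f Q (x + (f (1 + c) + f (1 + c) - f (2 + c) - f (3 + c)))) ∧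
    (P (x - (f (1 + c) + f (1 + c) - f (2 + c) - f (3 + c))) ∧
      IsCyclicallySurrounded f Q (x - (f (1 + c) + f (1 + c) - f (2 + c) - f (3 + c)))) := by
  obtain ⟨⟨p1, l1⟩, ⟨p2, l2⟩⟩ :=
    (h.comp (add_left_injective c)).translate_zero hx (hloc.rotate c)
  refine ⟨⟨p1, ?_⟩, ⟨p2, ?_⟩⟩
  · simpa [add_assoc] using l1.rotate (-c)
  · simpa [add_assoc] using l2.rotate (-c)

/-- The translations that preserve cyclically surrounded codewords. -/
def periods (f : Fin 4 → M) (P Q : M → Prop) : AddSubgroup M where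
  carrier := {r | ∀ x, (P (x + r) ∧ IsCyclicallySurrounded f Q (x + r)) ↔
    (P x ∧ IsCyclicallySurrounded f Q x)}
  zero_mem' x := by simp
  add_mem' {a b} ha hb x := by rw [← add_assoc, hb, ha]
  neg_mem' {a} ha x := by simpa using (ha (x + -a)).symm

lemma mem_periods (h : IsBipartiteCode f P Q) (c : Fin 4) :
    f (1 + c) + f (1 + c) - f (2 + c) - f (3 + c) ∈ periods f P Q := by
  intro x
  refine ⟨fun hx => ?_, fun hx => (h.translate c hx.1 hx.2).1⟩
  simpa using (h.translate c hx.1 hx.2).2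

/-- A code containing `0` is, up to a relabelling of `e`, determined by a linear form mod `5`. -/
theorem exists_linear (h : IsBipartiteCode e P Q) (he : e 0 = 0) (h0 : P 0) :
    ∃ σ : Fin 4 → Fin 4, Function.Injective σ ∧ σ 0 = 0 ∧
      (∀ a b c : ℤ, 5 ∣ 4 * a + b + 2 * c → P (a • e (σ 1) + b • e (σ 2) + c • e (σ 3))) ∧
      (∀ a b c : ℤ, 5 ∣ 4 * (a - 2) + b + 2 * c →
        Q (a • e (σ 1) + b • e (σ 2) + c • e (σ 3))) := by
  obtain ⟨σ, hσ, hσ0, hs⟩ := h.exists_isCyclicallySurrounded h0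
  refine ⟨σ, hσ, hσ0, ?_⟩
  have h' := h.comp hσ
  have key : ∀ a b c : ℤ, 5 ∣ 4 * a + b + 2 * c →
      a • e (σ 1) + b • e (σ 2) + c • e (σ 3) ∈ periods (fun i => e (σ i)) P Q := by
    rintro a b c ⟨d, hd⟩
    have m1 := h'.mem_periods 1
    have m2 := h'.mem_periods 2
    have m3 := h'.mem_periods 3
    have e0 : e (σ 0) = 0 := by rw [hσ0, he]
    -- With `e (σ 0) = 0` the periods are `(0, 2, -1)`, `(-1, 0, 2)`, `(-1, -1, 0)` in the
    -- directions `σ 1, σ 2, σ 3`. Their determinant is `-5`, so they span the whole kernel of `4a +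
    -- b + 2c` mod 5.
    have := add_mem (add_mem (zsmul_mem m3 (-d)) (zsmul_mem m1 (2 * d - 2 * a - c)))
      (zsmul_mem m2 (d - a))
    convert this using 1
    obtain rfl : b = 5 * d - 4 * a - 2 * c := by omega
    simp only [show (1 + 1 : Fin 4) = 2 from rfl, show (2 + 1 : Fin 4) = 3 from rfl,
      show (3 + 1 : Fin 4) = 0 from rfl, show (1 + 2 : Fin 4) = 3 from rfl,
      show (2 + 2 : Fin 4) = 0 from rfl, show (3 + 2 : Fin 4) = 1 from rfl,
      show (1 + 3 : Fin 4) = 0 from rfl, show (2 + 3 : Fin 4) = 1 from rfl,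
      show (3 + 3 : Fin 4) = 2 from rfl, e0]
    module
  have hP := fun a b c hd => (key a b c hd 0).2 ⟨h0, hs⟩
  simp only [zero_add] at hP
  refine ⟨fun a b c hd => (hP a b c hd).1, fun a b c hd => ?_⟩
  -- The second copy is reached from the first through the codeword at offset `2 f 1 - f 0`.
  have := ((hP (a - 2) b c hd).2 0).1
  convert this using 1
  simp only [zero_add, hσ0, he]
  module

end IsBipartiteCode

/-! ### Perfect codes of the square grid. -/

/-- Exactly one of five propositions holds. -/
def ExactlyOneOfFive (a b c d e : Prop) : Prop :=
  (a ∨ b ∨ c ∨ d ∨ e) ∧ ¬(a ∧ b) ∧ ¬(a ∧ c) ∧ ¬(a ∧ d) ∧ ¬(a ∧ e) ∧ ¬(b ∧ c) ∧ ¬(b ∧ d) ∧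
    ¬(b ∧ e) ∧ ¬(c ∧ d) ∧ ¬(c ∧ e) ∧ ¬(d ∧ e)

lemma ExactlyOneOfFive.swap {a b c d e : Prop} :
    ExactlyOneOfFive a b c d e ↔ ExactlyOneOfFive a c b e d := by
  constructor <;> rintro ⟨h, hab, hac, had, hae, hbc, hbd, hbe, hcd, hce, hde⟩ <;>
  refine ⟨?_, hac, hab, hae, had, fun h => hbc h.symm, hce, hcd, hbe, hbd, fun h => hde h.symm⟩ <;>
  rcases h with h | h | h | h | h <;> simp [h]

/-- A perfect code of the square grid. -/
def IsGridCode (R : ℤ → ℤ → Prop) : Prop :=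
  ∀ p q, ExactlyOneOfFive (R p q) (R p (q + 1)) (R p (q - 1)) (R (p + 1) q) (R (p - 1) q)

/-- The four codewords that a codeword at `(p, q)` meets by knight moves of chirality `δ`. -/
def KnightNeighbours (R : ℤ → ℤ → Prop) (δ p q : ℤ) : Prop :=
  R (p + 1) (q + 2 * δ) ∧ R (p - 2) (q + δ) ∧ R (p - 1) (q - 2 * δ) ∧ R (p + 2) (q - δ)

namespace IsGridCode

variable {R : ℤ → ℤ → Prop}

lemma unique_dominating (h : IsGridCode R) {c d p q p' q' : ℤ} (h1 : R p q) (h2 : R p' q')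
    (hd1 : (p - c).natAbs + (q - d).natAbs ≤ 1) (hd2 : (p' - c).natAbs + (q' - d).natAbs ≤ 1) :
    p = p' ∧ q = q' := by
  have ball : ∀ x y : ℤ, (x - c).natAbs + (y - d).natAbs ≤ 1 →
      (x = c ∧ y = d) ∨ (x = c ∧ y = d + 1) ∨ (x = c ∧ y = d - 1) ∨ (x = c + 1 ∧ y = d) ∨
        (x = c - 1 ∧ y = d) := by
    intro x y hxy
    omega
  obtain ⟨-, k1, k2, k3, k4, k5, k6, k7, k8, k9, k10⟩ := h c d
  rcases ball p q hd1 with ⟨rfl, rfl⟩ | ⟨rfl, rfl⟩ | ⟨rfl, rfl⟩ | ⟨rfl, rfl⟩ | ⟨rfl, rfl⟩ <;>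
  rcases ball p' q' hd2 with ⟨rfl, rfl⟩ | ⟨rfl, rfl⟩ | ⟨rfl, rfl⟩ | ⟨rfl, rfl⟩ | ⟨rfl, rfl⟩ <;>
  first
  | exact ⟨rfl, rfl⟩
  | exact absurd (And.intro h1 h2) (by assumption)
  | exact absurd (And.intro h2 h1) (by assumption)

/-- Two points at distance at most 2 have a common point within distance 1 of both. -/
lemma separated (h : IsGridCode R) {p q p' q' : ℤ} (h1 : R p q) (h2 : R p' q')
    (hd : (p - p').natAbs + (q - q').natAbs ≤ 2) : p = p' ∧ q = q' := by
  obtain ⟨c, d, hd1, hd2⟩ : ∃ c d : ℤ, (p - c).natAbs + (q - d).natAbs ≤ 1 ∧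
      (p' - c).natAbs + (q' - d).natAbs ≤ 1 := by
    rcases lt_trichotomy p p' with hp | hp | hp
    · exact ⟨p + 1, q, by omega, by omega⟩
    · rcases lt_trichotomy q q' with hq | hq | hq
      · exact ⟨p, q + 1, by omega, by omega⟩
      · exact ⟨p, q, by omega, by omega⟩
      · exact ⟨p, q - 1, by omega, by omega⟩
    · exact ⟨p - 1, q, by omega, by omega⟩
  exact h.unique_dominating h1 h2 hd1 hd2

/-- The diagonal neighbour `(p + a, q + b)` must be dominated, and of its five candidate codewords
all but the two outer ones lie within distance 2 of `(p, q)`. -/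
lemma corner (h : IsGridCode R) {p q : ℤ} (hR : R p q) {a b : ℤ} (ha : a = 1 ∨ a = -1)
    (hb : b = 1 ∨ b = -1) : R (p + 2 * a) (q + b) ∨ R (p + a) (q + 2 * b) := by
  have far : ∀ x y, R x y → (p - x).natAbs + (q - y).natAbs ≤ 2 → p = x ∧ q = y :=
    fun x y hxy => h.separated hR hxy
  have e : ∀ x y x' y', R x y → x = x' → y = y' → R x' y' := by
    rintro x y _ _ hxy rfl rfl
    exact hxy
  rcases (h (p + a) (q + b)).1 with h1 | h1 | h1 | h1 | h1
  · have := far _ _ h1 (by omega); omega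
  · by_cases hb1 : b = 1
    · exact .inr (e _ _ _ _ h1 (by omega) (by omega))
    · have := far _ _ h1 (by omega); omega
  · by_cases hb1 : b = -1
    · exact .inr (e _ _ _ _ h1 (by omega) (by omega))
    · have := far _ _ h1 (by omega); omega
  · by_cases ha1 : a = 1
    · exact .inl (e _ _ _ _ h1 (by omega) (by omega))
    · have := far _ _ h1 (by omega); omega
  · by_cases ha1 : a = -1
    · exact .inl (e _ _ _ _ h1 (by omega) (by omega))
    · have := far _ _ h1 (by omega); omega

/-- The choice at one corner excludes one option at an adjacent corner, so the first choice settles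
all four. -/
lemma exists_knightNeighbours (h : IsGridCode R) {p q : ℤ} (hR : R p q) :
    ∃ δ : ℤ, (δ = 1 ∨ δ = -1) ∧ KnightNeighbours R δ p q := by
  have no : ∀ x y x' y', R x y → R x' y' → (x - x').natAbs + (y - y').natAbs ≤ 2 →
      ¬(x = x' ∧ y = y') → False := fun x y x' y' h1 h2 hd hne => hne (h.separated h1 h2 hd)
  have e : ∀ x y x' y', R x y → x = x' → y = y' → R x' y' := by
    rintro x y _ _ hxy rfl rfl
    exact hxy
  have c1 := h.corner hR (a := 1) (b := 1) (.inl rfl) (.inl rfl)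
  have c2 := h.corner hR (a := -1) (b := 1) (.inr rfl) (.inl rfl)
  have c3 := h.corner hR (a := -1) (b := -1) (.inr rfl) (.inr rfl)
  have c4 := h.corner hR (a := 1) (b := -1) (.inl rfl) (.inr rfl)
  rcases c1 with c1 | c1
  · have c4 := c4.resolve_left fun c => no _ _ _ _ c1 c (by omega) (by omega)
    have c3 := c3.resolve_right fun c => no _ _ _ _ c4 c (by omega) (by omega)
    have c2 := c2.resolve_left fun c => no _ _ _ _ c3 c (by omega) (by omega)
    exact ⟨-1, .inr rfl, e _ _ _ _ c4 (by omega) (by omega), e _ _ _ _ c3 (by omega) (by omega),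
      e _ _ _ _ c2 (by omega) (by omega), e _ _ _ _ c1 (by omega) (by omega)⟩
  · have c2 := c2.resolve_right fun c => no _ _ _ _ c1 c (by omega) (by omega)
    have c3 := c3.resolve_left fun c => no _ _ _ _ c2 c (by omega) (by omega)
    have c4 := c4.resolve_right fun c => no _ _ _ _ c3 c (by omega) (by omega)
    exact ⟨1, .inl rfl, e _ _ _ _ c1 (by omega) (by omega), e _ _ _ _ c2 (by omega) (by omega),
      e _ _ _ _ c3 (by omega) (by omega), e _ _ _ _ c4 (by omega) (by omega)⟩

lemma knightNeighbours_step (h : IsGridCode R) {δ p q a b : ℤ} (hδ : δ = 1 ∨ δ = -1)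
    (hR : R p q) (hR' : R (p + a) (q + b))
    (hab : a = 1 ∧ b = 2 * δ ∨ a = -2 ∧ b = δ ∨ a = -1 ∧ b = -2 * δ ∨ a = 2 ∧ b = -δ) :
    KnightNeighbours R δ (p + a) (q + b) := by
  obtain ⟨δ', hδ', k⟩ := h.exists_knightNeighbours hR'
  by_cases hδδ : δ' = δ
  · exact hδδ ▸ k
  · exfalso
    -- The opposite chirality at the new codeword would place a codeword at distance 2 from `(p,
    -- q)`.
    have no : ∀ x y, R x y → (p - x).natAbs + (q - y).natAbs ≤ 2 → ¬(p = x ∧ q = y) → False :=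
      fun x y h1 hd hne => hne (h.separated hR h1 hd)
    obtain ⟨k1, k2, k3, k4⟩ := k
    rcases hab with hab | hab | hab | hab
    · exact no _ _ k2 (by omega) (by omega)
    · exact no _ _ k1 (by omega) (by omega)
    · exact no _ _ k4 (by omega) (by omega)
    · exact no _ _ k3 (by omega) (by omega)

/-- The perfect codes of the square grid that contain `(1, 0)` contain one of two lattices. -/
lemma exists_lattice_subset (h : IsGridCode R) (h0 : R 1 0) :
    ∃ δ : ℤ, (δ = 1 ∨ δ = -1) ∧ ∀ p q, 5 ∣ p - 1 + 2 * δ * q → R p q := by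
  obtain ⟨δ, hδ, hk⟩ := h.exists_knightNeighbours h0
  refine ⟨δ, hδ, ?_⟩
  have first : ∀ a p q, R p q ∧ KnightNeighbours R δ p q →
      R (p + a) (q + 2 * δ * a) ∧ KnightNeighbours R δ (p + a) (q + 2 * δ * a) := by
    intro a p q hpq
    induction a with
    | zero => simpa using hpq
    | succ i ih =>
      have := h.knightNeighbours_step hδ ih.1 ih.2.1 (.inl ⟨rfl, rfl⟩)
      have e1 : p + (i : ℤ) + 1 = p + (i + 1) := by ring
      have e2 : q + 2 * δ * (i : ℤ) + 2 * δ = q + 2 * δ * (i + 1) := by ring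
      exact ⟨e1 ▸ e2 ▸ ih.2.1, e1 ▸ e2 ▸ this⟩
    | pred i ih =>
      have e1 : p + (-(i : ℤ)) - 1 = p + (-i - 1) := by ring
      have e2 : q + 2 * δ * (-(i : ℤ)) - 2 * δ = q + 2 * δ * (-i - 1) := by ring
      have e3 : q + 2 * δ * (-(i : ℤ)) + -2 * δ = q + 2 * δ * (-i - 1) := by ring
      have hR : R (p + (-i - 1)) (q + 2 * δ * (-i - 1)) := e1 ▸ e2 ▸ ih.2.2.2.1
      have := h.knightNeighbours_step (a := -1) (b := -2 * δ) hδ ih.1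
        (by rw [e3, add_assoc]; exact hR) (by simp)
      rw [e3, add_assoc] at this
      exact ⟨hR, this⟩
  have second : ∀ b p q, R p q ∧ KnightNeighbours R δ p q →
      R (p - 2 * b) (q + δ * b) ∧ KnightNeighbours R δ (p - 2 * b) (q + δ * b) := by
    intro b p q hpq
    induction b with
    | zero => simpa using hpq
    | succ i ih =>
      have e1 : p - 2 * (i : ℤ) - 2 = p - 2 * (i + 1) := by ring
      have e1' : p - 2 * (i : ℤ) + -2 = p - 2 * (i + 1) := by ring
      have e2 : q + δ * (i : ℤ) + δ = q + δ * (i + 1) := by ring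
      have hR : R (p - 2 * (i + 1)) (q + δ * (i + 1)) := e1 ▸ e2 ▸ ih.2.2.1
      have := h.knightNeighbours_step (a := -2) (b := δ) hδ ih.1
        (by rw [e1', e2]; exact hR) (by simp)
      rw [e1', e2] at this
      exact ⟨hR, this⟩
    | pred i ih =>
      have e1 : p - 2 * (-(i : ℤ)) + 2 = p - 2 * (-i - 1) := by ring
      have e2 : q + δ * (-(i : ℤ)) - δ = q + δ * (-i - 1) := by ring
      have e2' : q + δ * (-(i : ℤ)) + -δ = q + δ * (-i - 1) := by ring
      have hR : R (p - 2 * (-i - 1)) (q + δ * (-i - 1)) := e1 ▸ e2 ▸ ih.2.2.2.2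
      have := h.knightNeighbours_step (a := 2) (b := -δ) hδ ih.1
        (by rw [e1, e2']; exact hR) (by simp)
      rw [e1, e2'] at this
      exact ⟨hR, this⟩
  rintro p q ⟨a, ha⟩
  -- The moves `(1, 2δ)` and `(-2, δ)` have determinant `5δ` and span the kernel of `p + 2δq` mod 5;
  -- solving for the number of moves of each kind gives `a` and `δq - 2a`.
  have := (second (δ * q - 2 * a) _ _ (first a _ _ ⟨h0, hk⟩)).1
  have e1 : 1 + a - 2 * (δ * q - 2 * a) = p := by linarith
  have e2 : 0 + 2 * δ * a + δ * (δ * q - 2 * a) = q := by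
    rcases hδ with rfl | rfl <;> ring
  rwa [e1, e2] at this

lemma of_linear {δ : ℤ} (hδ : δ = 1 ∨ δ = -1) :
    IsGridCode fun p q => 5 ∣ p - 1 + 2 * δ * q := by
  intro p q
  unfold ExactlyOneOfFive
  rcases hδ with rfl | rfl <;> refine ⟨?_, ?_, ?_, ?_, ?_, ?_, ?_, ?_, ?_, ?_, ?_⟩ <;> omega

/-- A point of `R` outside `R'` is adjacent to a point of `R'`, so the larger code would dominate it
twice. -/
lemma eq_of_le {R' : ℤ → ℤ → Prop} (h : IsGridCode R) (h' : IsGridCode R')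
    (hle : ∀ p q, R' p q → R p q) (p q : ℤ) : R p q ↔ R' p q := by
  refine ⟨fun hR => ?_, hle p q⟩
  obtain ⟨-, h1, h2, h3, h4, -⟩ := h p q
  rcases (h' p q).1 with k | k | k | k | k
  · exact k
  · exact absurd ⟨hR, hle _ _ k⟩ h1
  · exact absurd ⟨hR, hle _ _ k⟩ h2
  · exact absurd ⟨hR, hle _ _ k⟩ h3
  · exact absurd ⟨hR, hle _ _ k⟩ h4

/-- The perfect codes of the square grid that contain `(1, 0)`. -/
theorem exists_linear (h : IsGridCode R) (h0 : R 1 0) :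
    ∃ δ : ℤ, (δ = 1 ∨ δ = -1) ∧ ∀ p q, R p q ↔ 5 ∣ p - 1 + 2 * δ * q := by
  obtain ⟨δ, hδ, hle⟩ := h.exists_lattice_subset h0
  exact ⟨δ, hδ, h.eq_of_le (of_linear hδ) hle⟩

end IsGridCode

/-! ### Bipartite codes of `ℤ³` as admissible triples. -/

/-- The differences between the elements `x` of `G` and the neighbours of `x * t`, as exponent
vectors with respect to three generators. -/
def latticeStep : Fin 4 → ℤ × ℤ × ℤ := ![0, (1, 0, 0), (0, 1, 0), (0, 0, 1)]

lemma admissibleTriple_iff {v : ℕ} {a b : ℤ} :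
    AdmissibleTriple v a b ↔
      (v = 2 ∧ (a = 1 ∧ b = 2 ∨ a = 2 ∧ b = 1)) ∨ (v = 3 ∧ (a = 1 ∧ b = 3 ∨ a = 3 ∧ b = 1)) ∨
        (v = 4 ∧ (a = 2 ∧ b = 3 ∨ a = 3 ∧ b = 2)) := by
  have p2 : parity 2 = 0 := by norm_num [parity]
  have p3 : parity 3 = 1 := by norm_num [parity]
  have p4 : parity 4 = 0 := by norm_num [parity]
  simp only [AdmissibleTriple, Set.mem_insert_iff, Set.mem_singleton_iff, Set.pair_eq_pair_iff]
  constructor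
  · rintro ⟨rfl | rfl | rfl, h⟩ <;> simp only [p2, p3, p4] at h <;> push_cast at h <;> omega
  · rintro (⟨rfl, h⟩ | ⟨rfl, h⟩ | ⟨rfl, h⟩) <;> simp only [p2, p3, p4] <;>
    refine ⟨by simp, ?_⟩ <;> push_cast <;> omega

namespace IsBipartiteCode

lemma of_linear {v : ℕ} {a b : ℤ} (h : AdmissibleTriple v a b) :
    IsBipartiteCode latticeStep (fun x => 5 ∣ x.1 - a * x.2.1 - b * x.2.2)
      (fun x => 5 ∣ x.1 - a * x.2.1 - b * x.2.2 - v) := by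
  constructor
  all_goals
    rintro ⟨x, y, z⟩
    simp only [Fin.forall_fin_succ, Fin.exists_fin_succ, latticeStep]
    simp
    rcases admissibleTriple_iff.1 h with ⟨rfl, ⟨rfl, rfl⟩ | ⟨rfl, rfl⟩⟩ |
      ⟨rfl, ⟨rfl, rfl⟩ | ⟨rfl, rfl⟩⟩ | ⟨rfl, ⟨rfl, rfl⟩ | ⟨rfl, rfl⟩⟩ <;> push_cast <;> omega

lemma eq_of_le {M : Type*} [AddCommGroup M] {e : Fin 4 → M} {P Q P' Q' : M → Prop}
    (h : IsBipartiteCode e P Q) (h' : IsBipartiteCode e P' Q') (hP : ∀ x, P' x → P x)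
    (hQ : ∀ x, Q' x → Q x) : (∀ x, P x ↔ P' x) ∧ ∀ x, Q x ↔ Q' x := by
  refine ⟨fun x => ⟨fun hx => ?_, hP x⟩, fun x => ⟨fun hx => ?_, hQ x⟩⟩
  · exact (h'.cover_left x).resolve_right fun ⟨i, hi⟩ => h.disjoint x i hx (hQ _ hi)
  · exact (h'.cover_right x).resolve_right fun ⟨i, hi⟩ =>
      h.disjoint _ i (hP _ hi) (by simpa using hx)

/-- The six labellings `σ` of the directions correspond to the six admissible triples, once the form
`4a + b + 2c` is rescaled mod 5 to have coefficient 1 at the first coordinate. -/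
theorem exists_admissibleTriple {P Q : ℤ × ℤ × ℤ → Prop} (h : IsBipartiteCode latticeStep P Q)
    (h0 : P 0) :
    ∃ (v : ℕ) (a b : ℤ), AdmissibleTriple v a b ∧
      (∀ x, P x ↔ 5 ∣ x.1 - a * x.2.1 - b * x.2.2) ∧
      ∀ x, Q x ↔ 5 ∣ x.1 - a * x.2.1 - b * x.2.2 - v := by
  suffices H : ∃ (v : ℕ) (a b : ℤ), AdmissibleTriple v a b ∧
      (∀ x y z : ℤ, 5 ∣ x - a * y - b * z → P (x, y, z)) ∧
      ∀ x y z : ℤ, 5 ∣ x - a * y - b * z - v → Q (x, y, z) by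
    obtain ⟨v, a, b, hv, hP, hQ⟩ := H
    exact ⟨v, a, b, hv, h.eq_of_le (of_linear hv) (fun x => hP x.1 x.2.1 x.2.2)
      fun x => hQ x.1 x.2.1 x.2.2⟩
  obtain ⟨σ, hσ, hσ0, hP, hQ⟩ := h.exists_linear rfl h0
  have hcases : (σ 1 = 1 ∧ σ 2 = 2 ∧ σ 3 = 3) ∨ (σ 1 = 1 ∧ σ 2 = 3 ∧ σ 3 = 2) ∨
      (σ 1 = 2 ∧ σ 2 = 1 ∧ σ 3 = 3) ∨ (σ 1 = 3 ∧ σ 2 = 1 ∧ σ 3 = 2) ∨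
      (σ 1 = 2 ∧ σ 2 = 3 ∧ σ 3 = 1) ∨ (σ 1 = 3 ∧ σ 2 = 2 ∧ σ 3 = 1) := by
    have h10 := hσ.ne (show (1 : Fin 4) ≠ 0 by decide)
    have h20 := hσ.ne (show (2 : Fin 4) ≠ 0 by decide)
    have h30 := hσ.ne (show (3 : Fin 4) ≠ 0 by decide)
    have h12 := hσ.ne (show (1 : Fin 4) ≠ 2 by decide)
    have h13 := hσ.ne (show (1 : Fin 4) ≠ 3 by decide)
    have h23 := hσ.ne (show (2 : Fin 4) ≠ 3 by decide)
    rw [hσ0] at h10 h20 h30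
    generalize σ 1 = a at *
    generalize σ 2 = b at *
    generalize σ 3 = c at *
    clear * - h10 h20 h30 h12 h13 h23
    fin_cases a <;> simp at h10 <;> fin_cases b <;> simp at h20 h12 <;> fin_cases c <;>
      simp at h30 h13 h23 ⊢
  have e1 : latticeStep 1 = (1, 0, 0) := rfl
  have e2 : latticeStep 2 = (0, 1, 0) := rfl
  have e3 : latticeStep 3 = (0, 0, 1) := rfl
  rcases hcases with ⟨h1, h2, h3⟩ | ⟨h1, h2, h3⟩ | ⟨h1, h2, h3⟩ | ⟨h1, h2, h3⟩ | ⟨h1, h2, h3⟩ |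
    ⟨h1, h2, h3⟩ <;>
  simp only [h1, h2, h3, e1, e2, e3, Prod.smul_mk, smul_eq_mul, mul_one, mul_zero,
    Prod.mk_add_mk, add_zero, zero_add] at hP hQ
  · exact ⟨2, 1, 2, admissibleTriple_iff.2 (by simp),
      fun x y z _ => hP x y z (by omega), fun x y z _ => hQ x y z (by omega)⟩
  · exact ⟨2, 2, 1, admissibleTriple_iff.2 (by simp),
      fun x y z _ => hP x z y (by omega), fun x y z _ => hQ x z y (by omega)⟩
  · exact ⟨3, 1, 3, admissibleTriple_iff.2 (by simp),
      fun x y z _ => hP y x z (by omega), fun x y z _ => hQ y x z (by omega)⟩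
  · exact ⟨3, 3, 1, admissibleTriple_iff.2 (by simp),
      fun x y z _ => hP z x y (by omega), fun x y z _ => hQ z x y (by omega)⟩
  · exact ⟨4, 3, 2, admissibleTriple_iff.2 (by simp),
      fun x y z _ => hP y z x (by omega), fun x y z _ => hQ y z x (by omega)⟩
  · exact ⟨4, 2, 3, admissibleTriple_iff.2 (by simp),
      fun x y z _ => hP z y x (by omega), fun x y z _ => hQ z y x (by omega)⟩

end IsBipartiteCode

/-! ### Exponent vectors and relations mod 5. -/

/-- The product `s₀ ^ i * s₁ ^ j * s₂ ^ k` with exponent vector `(i, j, k)`. -/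
def word {G : Type*} [Group G] (s₀ s₁ s₂ : G) (x : ℤ × ℤ × ℤ) : G :=
  s₀ ^ x.1 * s₁ ^ x.2.1 * s₂ ^ x.2.2

section Word

variable {G : Type*} [Group G] {s₀ s₁ s₂ : G}

lemma word_zero : word s₀ s₁ s₂ 0 = 1 := by simp [word]

lemma word_add (h01 : Commute s₀ s₁) (h02 : Commute s₀ s₂) (h12 : Commute s₁ s₂)
    (x y : ℤ × ℤ × ℤ) : word s₀ s₁ s₂ (x + y) = word s₀ s₁ s₂ x * word s₀ s₁ s₂ y := by
  have c1 : Commute (s₁ ^ x.2.1) (s₀ ^ y.1) := (h01.zpow_zpow _ _).symm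
  have c2 : Commute (s₂ ^ x.2.2) (s₀ ^ y.1 * s₁ ^ y.2.1) :=
    (h02.zpow_zpow _ _).symm.mul_right (h12.zpow_zpow _ _).symm
  simp only [word, Prod.fst_add, Prod.snd_add, zpow_add]
  calc s₀ ^ x.1 * s₀ ^ y.1 * (s₁ ^ x.2.1 * s₁ ^ y.2.1) * (s₂ ^ x.2.2 * s₂ ^ y.2.2)
      = s₀ ^ x.1 * (s₀ ^ y.1 * s₁ ^ x.2.1) * s₁ ^ y.2.1 * s₂ ^ x.2.2 * s₂ ^ y.2.2 := by group
    _ = s₀ ^ x.1 * s₁ ^ x.2.1 * (s₀ ^ y.1 * s₁ ^ y.2.1 * s₂ ^ x.2.2) * s₂ ^ y.2.2 := by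
      rw [← c1.eq]; group
    _ = s₀ ^ x.1 * s₁ ^ x.2.1 * s₂ ^ x.2.2 * (s₀ ^ y.1 * s₁ ^ y.2.1 * s₂ ^ y.2.2) := by
      rw [← c2.eq]; group

lemma word_neg (h01 : Commute s₀ s₁) (h02 : Commute s₀ s₂) (h12 : Commute s₁ s₂)
    (x : ℤ × ℤ × ℤ) : word s₀ s₁ s₂ (-x) = (word s₀ s₁ s₂ x)⁻¹ := by
  rw [eq_inv_iff_mul_eq_one, ← word_add h01 h02 h12, neg_add_cancel, word_zero]

lemma word_zsmul (h01 : Commute s₀ s₁) (h02 : Commute s₀ s₂) (h12 : Commute s₁ s₂)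
    (n : ℤ) (x : ℤ × ℤ × ℤ) : word s₀ s₁ s₂ (n • x) = word s₀ s₁ s₂ x ^ n := by
  induction n with
  | zero => simp [word_zero]
  | succ i ih => rw [add_smul, one_smul, word_add h01 h02 h12, ih, zpow_add_one]
  | pred i ih =>
    rw [sub_smul, one_smul, sub_eq_add_neg, word_add h01 h02 h12, ih, word_neg h01 h02 h12,
      zpow_sub_one]

lemma exists_zpow_mul_zpow_of_mem_closure_pair (h01 : Commute s₀ s₁) {g : G}
    (hg : g ∈ Subgroup.closure {s₀, s₁}) : ∃ i j : ℤ, g = s₀ ^ i * s₁ ^ j := by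
  suffices H : ∃ x : ℤ × ℤ × ℤ, g = word s₀ s₁ 1 x by
    obtain ⟨x, rfl⟩ := H
    exact ⟨x.1, x.2.1, by simp [word]⟩
  have c02 : Commute s₀ 1 := Commute.one_right _
  have c12 : Commute s₁ 1 := Commute.one_right _
  induction hg using Subgroup.closure_induction with
  | mem x hx =>
    rcases hx with rfl | rfl
    · exact ⟨(1, 0, 0), by simp [word]⟩
    · exact ⟨(0, 1, 0), by simp [word]⟩
  | one => exact ⟨0, word_zero.symm⟩
  | mul x y _ _ hx hy =>
    obtain ⟨a, rfl⟩ := hx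
    obtain ⟨b, rfl⟩ := hy
    exact ⟨a + b, (word_add h01 c02 c12 a b).symm⟩
  | inv x _ hx =>
    obtain ⟨a, rfl⟩ := hx
    exact ⟨-a, (word_neg h01 c02 c12 a).symm⟩

/-- The linear form `x ↦ x₀ - a x₁ - b x₂` vanishes mod `5` on the relations between
`s₀, s₁, s₂`. -/
def RelationsVanish (s₀ s₁ s₂ : G) (a b : ℤ) : Prop :=
  ∀ x, word s₀ s₁ s₂ x = 1 → 5 ∣ x.1 - a * x.2.1 - b * x.2.2

lemma RelationsVanish.five_dvd_orderOf {a b : ℤ} (h : RelationsVanish s₀ s₁ s₂ a b) :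
    5 ∣ orderOf s₀ := by
  have := h ((orderOf s₀ : ℤ), 0, 0) (by simp [word, pow_orderOf_eq_one])
  simp at this
  omega

lemma RelationsVanish.congr (h01 : Commute s₀ s₁) (h02 : Commute s₀ s₂) (h12 : Commute s₁ s₂)
    {a b : ℤ} (h : RelationsVanish s₀ s₁ s₂ a b) {x y : ℤ × ℤ × ℤ}
    (hxy : word s₀ s₁ s₂ x = word s₀ s₁ s₂ y) :
    5 ∣ (x.1 - a * x.2.1 - b * x.2.2) - (y.1 - a * y.2.1 - b * y.2.2) := by
  have := h (x + -y) (by rw [word_add h01 h02 h12, word_neg h01 h02 h12, hxy, mul_inv_cancel])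
  simp only [Prod.fst_add, Prod.snd_add, Prod.fst_neg, Prod.snd_neg] at this
  convert this using 1
  ring

lemma dvd_of_zpow_mem_of_isLeast {H : Subgroup G} {s : G} {m : ℕ}
    (hm : IsLeast {i : ℕ | 0 < i ∧ s ^ i ∈ H} m) {k : ℤ} (hk : s ^ k ∈ H) : (m : ℤ) ∣ k := by
  have hpos : (0 : ℤ) < m := by exact_mod_cast hm.1.1
  have h1 : s ^ (k % m) ∈ H := by
    rw [Int.emod_def, zpow_sub, zpow_mul]
    exact mul_mem hk (inv_mem (zpow_mem (by simpa using hm.1.2) _))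
  obtain ⟨r, hr⟩ := Int.eq_ofNat_of_zero_le (Int.emod_nonneg k hpos.ne')
  have hlt := Int.emod_lt_of_pos k hpos
  by_contra hnd
  have hr0 : 0 < r := by
    rcases Nat.eq_zero_or_pos r with rfl | h
    · exact absurd (Int.dvd_of_emod_eq_zero hr) hnd
    · exact h
  have := hm.2 ⟨hr0, by simpa [hr] using h1⟩
  omega

lemma exists_zpow_eq_of_five_dvd [Finite G] {s : G} (h5 : 5 ∣ orderOf s) (q r : ℤ) :
    ∃ w < orderOf s / 5, s ^ (5 * q + r) = s ^ (5 * (w : ℤ) + r) := by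
  obtain ⟨N, hN⟩ := h5
  have hpos : 0 < orderOf s := orderOf_pos s
  have hN0 : (0 : ℤ) < N := by omega
  obtain ⟨w, hw⟩ := Int.eq_ofNat_of_zero_le (Int.emod_nonneg q hN0.ne')
  -- Changing `q` by a multiple of `orderOf s / 5` changes the exponent by a multiple of the order.
  have hlt := Int.emod_lt_of_pos q hN0
  refine ⟨w, by omega, ?_⟩
  rw [zpow_eq_zpow_iff_modEq, hN]
  have := Int.mul_ediv_add_emod q N
  rw [hw] at this
  rw [Int.modEq_iff_dvd]
  exact ⟨-(q / N), by push_cast; linear_combination 5 * this⟩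

/-- Reduction of exponents to the ranges given by `m` and `l`. -/
lemma exists_reduced_word (h01 : Commute s₀ s₁) (h02 : Commute s₀ s₂) (h12 : Commute s₁ s₂)
    {m l : ℕ} (hm : IsLeast {i : ℕ | 0 < i ∧ s₁ ^ i ∈ Subgroup.zpowers s₀} m)
    (hl : IsLeast {i : ℕ | 0 < i ∧ s₂ ^ i ∈ Subgroup.closure {s₀, s₁}} l) (x : ℤ × ℤ × ℤ) :
    ∃ i : ℤ, ∃ j < m, ∃ k < l, word s₀ s₁ s₂ x = word s₀ s₁ s₂ (i, (j : ℤ), (k : ℤ)) := by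
  obtain ⟨c, hc⟩ := Subgroup.mem_zpowers_iff.1 hm.1.2
  obtain ⟨c', d', hc'⟩ := exists_zpow_mul_zpow_of_mem_closure_pair h01 hl.1.2
  have hm0 : (0 : ℤ) < m := by exact_mod_cast hm.1.1
  have hl0 : (0 : ℤ) < l := by exact_mod_cast hl.1.1
  have r1 : word s₀ s₁ s₂ (-c, (m : ℤ), 0) = 1 := by simp [word, hc]
  have r2 : word s₀ s₁ s₂ (-c', -d', (l : ℤ)) = 1 := by
    simp only [word, zpow_natCast, hc']
    rw [mul_assoc, ← mul_assoc (s₁ ^ (-d')), ← (h01.zpow_zpow c' (-d')).eq]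
    group
  have drop : ∀ (q : ℤ) (y r : ℤ × ℤ × ℤ), word s₀ s₁ s₂ r = 1 →
      word s₀ s₁ s₂ (y + q • r) = word s₀ s₁ s₂ y := by
    intro q y r hr
    rw [word_add h01 h02 h12, word_zsmul h01 h02 h12, hr, one_zpow, mul_one]
  obtain ⟨i, j, k⟩ := x
  obtain ⟨k', hk'⟩ := Int.eq_ofNat_of_zero_le (Int.emod_nonneg k hl0.ne')
  have hk'l := Int.emod_lt_of_pos k hl0
  set j₁ : ℤ := j + d' * (k / l) with hj₁
  obtain ⟨j', hj'⟩ := Int.eq_ofNat_of_zero_le (Int.emod_nonneg j₁ hm0.ne')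
  have hj'm := Int.emod_lt_of_pos j₁ hm0
  -- Subtracting `k / l` copies of `r2` reduces the last exponent but shifts the middle one to `j₁`;
  -- `j₁ / m` copies of `r1` then reduce that.
  refine ⟨i + c' * (k / l) + c * (j₁ / m), j', by omega, k', by omega, ?_⟩
  rw [← drop (-(k / l)) _ _ r2, ← drop (-(j₁ / m)) _ _ r1]
  congr 1
  have e1 := Int.mul_ediv_add_emod k l
  have e2 := Int.mul_ediv_add_emod j₁ m
  rw [hk'] at e1
  rw [hj'] at e2
  simp only [Prod.smul_mk, Prod.mk_add_mk, smul_eq_mul, Prod.mk.injEq]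
  refine ⟨by ring, ?_, ?_⟩
  · linear_combination -e2 + hj₁.symm
  · linear_combination -e1

/-- By minimality of `m` and `l`, the relation lattice has a triangular basis: one relation
involving `s₀` alone, one with `s₁` to the power `m`, one with `s₂` to the power `l`. The three
clauses of the condition say that the form vanishes mod 5 on each. -/
theorem conditionTwo_iff_relationsVanish [Finite G] (h01 : Commute s₀ s₁) (h02 : Commute s₀ s₂)
    (h12 : Commute s₁ s₂) {m l : ℕ}
    (hm : IsLeast {i : ℕ | 0 < i ∧ s₁ ^ i ∈ Subgroup.zpowers s₀} m)
    (hl : IsLeast {i : ℕ | 0 < i ∧ s₂ ^ i ∈ Subgroup.closure {s₀, s₁}} l) {a b : ℤ} :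
    ConditionTwo s₀ s₁ s₂ m l a b ↔ RelationsVanish s₀ s₁ s₂ a b := by
  constructor
  · rintro ⟨h5, α₁, -, α₂, -, j, -, h1, h2⟩ ⟨x, y, z⟩ hx
    have r1 : word s₀ s₁ s₂ (-(5 * α₁ - a * m), (m : ℤ), 0) = 1 := by
      simp only [word, zpow_natCast, h1]
      simp [-neg_sub]
    have r2 : word s₀ s₁ s₂ (-(5 * α₂ - b * l + a * j), -(j : ℤ), (l : ℤ)) = 1 := by
      simp only [word, zpow_natCast, h2]
      rw [mul_assoc, ← mul_assoc (s₁ ^ (-(j : ℤ))), ← (h01.zpow_zpow _ (-(j : ℤ))).eq]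
      simp [-neg_sub, -neg_add_rev]
    obtain ⟨z', rfl⟩ : (l : ℤ) ∣ z := by
      refine dvd_of_zpow_mem_of_isLeast hl ?_
      have : s₂ ^ z = (s₀ ^ x * s₁ ^ y)⁻¹ := eq_inv_of_mul_eq_one_right hx
      rw [this]
      exact inv_mem (mul_mem (zpow_mem (Subgroup.subset_closure (by simp)) _)
        (zpow_mem (Subgroup.subset_closure (by simp)) _))
    -- Multiples of `r2`, then of `r1`, clear the last two exponents; what is left is a power of
    -- `s₀` equal to 1, whose exponent is divisible by the order and hence by 5.
    have hx' := word_add h01 h02 h12 (x, y, l * z')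
      ((-z') • (-(5 * α₂ - b * l + a * j), -(j : ℤ), (l : ℤ)))
    rw [hx, word_zsmul h01 h02 h12, r2, one_zpow, mul_one] at hx'
    simp only [Prod.smul_mk, Prod.mk_add_mk, smul_eq_mul] at hx'
    rw [show (l : ℤ) * z' + -z' * l = 0 by ring] at hx'
    obtain ⟨y', hy'⟩ : (m : ℤ) ∣ y + -z' * -j := by
      refine dvd_of_zpow_mem_of_isLeast hm ?_
      have := eq_inv_of_mul_eq_one_right (by simpa [word] using hx' :
        s₀ ^ (x + -z' * -(5 * α₂ - b * l + a * j)) * s₁ ^ (y + -z' * -j) = 1)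
      rw [this]
      exact inv_mem (zpow_mem (Subgroup.mem_zpowers s₀) _)
    rw [hy'] at hx'
    have hx'' := word_add h01 h02 h12 (x + -z' * -(5 * α₂ - b * l + a * j), m * y', 0)
      ((-y') • (-(5 * α₁ - a * m), (m : ℤ), 0))
    rw [hx', word_zsmul h01 h02 h12, r1, one_zpow, mul_one] at hx''
    simp only [Prod.smul_mk, Prod.mk_add_mk, smul_eq_mul] at hx''
    rw [show (m : ℤ) * y' + -y' * m = 0 by ring] at hx''
    have hdvd : (5 : ℤ) ∣ x + -z' * -(5 * α₂ - b * l + a * j) + -y' * -(5 * α₁ - a * m) :=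
      (Int.natCast_dvd_natCast.2 h5).trans
        (orderOf_dvd_iff_zpow_eq_one.2 (by simpa [word] using hx''))
    obtain ⟨d, hd⟩ := hdvd
    refine ⟨d - z' * α₂ - y' * α₁, ?_⟩
    linear_combination hd - a * hy'
  · intro h
    have h5 := h.five_dvd_orderOf
    obtain ⟨c, hc⟩ := Subgroup.mem_zpowers_iff.1 hm.1.2
    obtain ⟨c', d', hc'⟩ := exists_zpow_mul_zpow_of_mem_closure_pair h01 hl.1.2
    have hm0 : (0 : ℤ) < m := by exact_mod_cast hm.1.1
    obtain ⟨j, hj⟩ := Int.eq_ofNat_of_zero_le (Int.emod_nonneg d' hm0.ne')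
    have hjm := Int.emod_lt_of_pos d' hm0
    have ed := Int.mul_ediv_add_emod d' m
    rw [hj] at ed
    have hl2 : s₂ ^ l = s₀ ^ (c' + c * (d' / m)) * s₁ ^ j := by
      rw [hc', ← ed, zpow_add, zpow_mul, zpow_natCast, ← hc, ← zpow_mul, ← mul_assoc, ← zpow_add,
        zpow_natCast]
      simp [ed]
    obtain ⟨q₁, hq₁⟩ := h.congr h01 h02 h12 (x := (c, 0, 0)) (y := (0, (m : ℤ), 0))
      (by simp [word, hc])
    obtain ⟨q₂, hq₂⟩ := h.congr h01 h02 h12 (x := (c' + c * (d' / m), (j : ℤ), 0))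
      (y := (0, 0, (l : ℤ))) (by simp [word, hl2])
    simp only at hq₁ hq₂
    obtain ⟨w₁, hw₁, e₁⟩ := exists_zpow_eq_of_five_dvd h5 q₁ (-a * m)
    obtain ⟨w₂, hw₂, e₂⟩ := exists_zpow_eq_of_five_dvd h5 q₂ (-b * l + a * j)
    refine ⟨h5, w₁, hw₁, w₂, hw₂, j, by omega, ?_, ?_⟩
    · rw [← hc, show c = 5 * q₁ + -a * m by linear_combination hq₁, e₁]
      congr 1; ring
    · rw [hl2, show c' + c * (d' / m) = 5 * q₂ + (-b * l + a * j) by linear_combination hq₂, e₂]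
      congr 2; ring

lemma exists_codeTwo_word [Finite G] (h01 : Commute s₀ s₁) (h02 : Commute s₀ s₂)
    (h12 : Commute s₁ s₂) {m l : ℕ}
    (hm : IsLeast {i : ℕ | 0 < i ∧ s₁ ^ i ∈ Subgroup.zpowers s₀} m)
    (hl : IsLeast {i : ℕ | 0 < i ∧ s₂ ^ i ∈ Subgroup.closure {s₀, s₁}} l) {a b : ℤ}
    (h : RelationsVanish s₀ s₁ s₂ a b) (r : ℤ) {x : ℤ × ℤ × ℤ}
    (hx : 5 ∣ x.1 - a * x.2.1 - b * x.2.2 - r) :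
    ∃ α < orderOf s₀ / 5, ∃ j < m, ∃ k < l,
      word s₀ s₁ s₂ x = word s₀ s₁ s₂ (5 * (α : ℤ) + a * j + b * k + r, (j : ℤ), (k : ℤ)) := by
  obtain ⟨i, j, hj, k, hk, e⟩ := exists_reduced_word h01 h02 h12 hm hl x
  have hd := h.congr h01 h02 h12 e
  obtain ⟨q, hq⟩ := dvd_sub hx hd
  simp only at hq
  obtain ⟨w, hw, ew⟩ := exists_zpow_eq_of_five_dvd h.five_dvd_orderOf q (a * j + b * k + r)
  refine ⟨w, hw, j, hj, k, hk, ?_⟩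
  rw [e, word, word]
  congr 2
  rw [show i = 5 * q + (a * j + b * k + r) by linear_combination hq, ew]
  congr 1
  ring

end Word

/-! ### Perfect codes of the Cayley graph. -/

lemma injective_of_range_ncard_eq {α : Type*} {n : ℕ} {c : Fin n → α}
    (h : (Set.range c).ncard = n) : Function.Injective c := by
  rw [← Set.image_univ] at h
  refine Set.injOn_univ.1 (Set.injOn_of_ncard_image_eq ?_)
  simpa using h

section Graph

variable {G : Type*} [Group G] {S : Set G}

lemma IsQuarticConnectionSet.adj_iff (hS : IsQuarticConnectionSet S) (d x : G) :
    (SimpleGraph.mulCayley S).Adj d x ↔ ∃ g ∈ S, d = x * g := by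
  rw [SimpleGraph.mulCayley_adj]
  constructor
  · rintro ⟨-, h | h⟩
    · exact ⟨_, hS.inv_mem _ h, by group⟩
    · exact ⟨_, h, by group⟩
  · rintro ⟨g, hg, rfl⟩
    refine ⟨fun h => hS.one_notMem ?_, .inr (by simpa using hg)⟩
    rwa [mul_eq_left.1 h] at hg

/-- A set that contains `1` and is closed under right multiplication by `S` is everything. -/
lemma IsQuarticConnectionSet.induction (hS : IsQuarticConnectionSet S) {p : G → Prop} (h1 : p 1)
    (hmul : ∀ x, p x → ∀ g ∈ S, p (x * g)) (x : G) : p x := by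
  have hx := (SimpleGraph.reachable_iff_reflTransGen _ _).1 (hS.connected.preconnected 1 x)
  induction hx with
  | refl => exact h1
  | tail _ hadj ih =>
    obtain ⟨g, hg, rfl⟩ := (hS.adj_iff _ _).1 hadj.symm
    exact hmul _ ih g hg

lemma isPerfectCode_iff (hS : IsQuarticConnectionSet S) {c : Fin 4 → G} (hc : S = Set.range c)
    (D : Set G) :
    IsPerfectCode (SimpleGraph.mulCayley S) D ↔
      ∀ x, (x ∈ D ∨ ∃ i, x * c i ∈ D) ∧ (∀ i, x ∈ D → x * c i ∉ D) ∧
        ∀ i j, x * c i ∈ D → x * c j ∈ D → i = j := by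
  have hinj : Function.Injective c := injective_of_range_ncard_eq (hc ▸ hS.card_four)
  have hne : ∀ i, c i ≠ 1 := fun i hi => hS.one_notMem (by rw [hc, ← hi]; exact ⟨i, rfl⟩)
  have hadj : ∀ d x, (SimpleGraph.mulCayley S).Adj d x ↔ ∃ i, d = x * c i := by
    intro d x
    rw [hS.adj_iff, hc]
    simp
  unfold IsPerfectCode
  refine forall_congr' fun x => ?_
  simp only [hadj]
  constructor
  · rintro ⟨d, ⟨hd, hdx⟩, huniq⟩
    refine ⟨?_, fun i hx hxi => ?_, fun i j hi hj => ?_⟩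
    · rcases hdx with rfl | ⟨i, rfl⟩
      exacts [.inl hd, .inr ⟨i, hd⟩]
    · have := (huniq x ⟨hx, .inl rfl⟩).trans (huniq _ ⟨hxi, .inr ⟨i, rfl⟩⟩).symm
      exact hne i (by simpa using this)
    · have := (huniq _ ⟨hi, .inr ⟨i, rfl⟩⟩).trans (huniq _ ⟨hj, .inr ⟨j, rfl⟩⟩).symm
      exact hinj (by simpa using this)
  · rintro ⟨hcov, hdis, huniq⟩
    rcases hcov with hx | ⟨i, hi⟩
    · refine ⟨x, ⟨hx, .inl rfl⟩, ?_⟩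
      rintro d ⟨hd, rfl | ⟨j, rfl⟩⟩
      exacts [rfl, absurd hd (hdis j hx)]
    · refine ⟨x * c i, ⟨hi, .inr ⟨i, rfl⟩⟩, ?_⟩
      rintro d ⟨hd, rfl | ⟨j, rfl⟩⟩
      · exact absurd hi (hdis i hd)
      · rw [huniq j i hd hi]

lemma isPerfectCode_iff_exactlyOneOfFive (hS : IsQuarticConnectionSet S) {a b c d : G}
    (hc : S = {a, b, c, d}) (D : Set G) :
    IsPerfectCode (SimpleGraph.mulCayley S) D ↔
      ∀ x, ExactlyOneOfFive (x ∈ D) (x * a ∈ D) (x * b ∈ D) (x * c ∈ D) (x * d ∈ D) := by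
  rw [isPerfectCode_iff hS (c := ![a, b, c, d]) (by
    rw [hc]; ext; simp [eq_comm]; tauto)]
  refine forall_congr' fun x => ?_
  simp only [Fin.forall_fin_succ, Fin.exists_fin_succ, ExactlyOneOfFive]
  simp
  generalize (x ∈ D) = p0
  generalize (x * a ∈ D) = p1
  generalize (x * b ∈ D) = p2
  generalize (x * c ∈ D) = p3
  generalize (x * d ∈ D) = p4
  by_cases p0 <;> by_cases p1 <;> by_cases p2 <;> by_cases p3 <;> by_cases p4 <;> simp [*]

end Graph

/-! ### Words in the dihedral group and the explicit codes. -/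

section Dihedral

variable {G : Type*} [Group G] {A : Subgroup G} {t s₀ s₁ s₂ : G}

lemma word_mem (h0 : s₀ ∈ A) (h1 : s₁ ∈ A) (h2 : s₂ ∈ A) (x : ℤ × ℤ × ℤ) :
    word s₀ s₁ s₂ x ∈ A :=
  mul_mem (mul_mem (zpow_mem h0 _) (zpow_mem h1 _)) (zpow_mem h2 _)

lemma IsGeneralizedDihedral.commute (hG : IsGeneralizedDihedral A t) {x y : G} (hx : x ∈ A)
    (hy : y ∈ A) : Commute x y := hG.comm x hx y hy

lemma IsGeneralizedDihedral.mul_self (hG : IsGeneralizedDihedral A t) : t * t = 1 := by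
  rw [← pow_two, ← hG.order_two, pow_orderOf_eq_one]

lemma IsGeneralizedDihedral.mul_comm (hG : IsGeneralizedDihedral A t) {x : G} (hx : x ∈ A) :
    t * x = x⁻¹ * t := by
  rw [← hG.conj x hx, mul_assoc (t * x), hG.mul_self, mul_one]

lemma IsGeneralizedDihedral.word_add (hG : IsGeneralizedDihedral A t) (h0 : s₀ ∈ A)
    (h1 : s₁ ∈ A) (h2 : s₂ ∈ A) (x y : ℤ × ℤ × ℤ) :
    word s₀ s₁ s₂ (x + y) = word s₀ s₁ s₂ x * word s₀ s₁ s₂ y :=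
  _root_.word_add (hG.commute h0 h1) (hG.commute h0 h2) (hG.commute h1 h2) x y

lemma IsGeneralizedDihedral.mul_word (hG : IsGeneralizedDihedral A t) (h0 : s₀ ∈ A)
    (h1 : s₁ ∈ A) (h2 : s₂ ∈ A) (x : ℤ × ℤ × ℤ) :
    t * word s₀ s₁ s₂ x = word s₀ s₁ s₂ (-x) * t := by
  rw [hG.mul_comm (word_mem h0 h1 h2 x),
    word_neg (hG.commute h0 h1) (hG.commute h0 h2) (hG.commute h1 h2)]

lemma IsGeneralizedDihedral.word_mul_t_word (hG : IsGeneralizedDihedral A t) (h0 : s₀ ∈ A)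
    (h1 : s₁ ∈ A) (h2 : s₂ ∈ A) (x y : ℤ × ℤ × ℤ) :
    word s₀ s₁ s₂ x * (t * word s₀ s₁ s₂ y) = word s₀ s₁ s₂ (x - y) * t := by
  rw [hG.mul_word h0 h1 h2, ← mul_assoc, ← hG.word_add h0 h1 h2, sub_eq_add_neg]

lemma IsGeneralizedDihedral.word_t_mul_t_word (hG : IsGeneralizedDihedral A t) (h0 : s₀ ∈ A)
    (h1 : s₁ ∈ A) (h2 : s₂ ∈ A) (x y : ℤ × ℤ × ℤ) :
    word s₀ s₁ s₂ x * t * (t * word s₀ s₁ s₂ y) = word s₀ s₁ s₂ (x + y) := by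
  rw [hG.word_add h0 h1 h2, mul_assoc, ← mul_assoc t, hG.mul_self, one_mul]

lemma IsGeneralizedDihedral.word_ne (hG : IsGeneralizedDihedral A t) (h0 : s₀ ∈ A)
    (h1 : s₁ ∈ A) (h2 : s₂ ∈ A) (x y : ℤ × ℤ × ℤ) :
    word s₀ s₁ s₂ x * t ≠ word s₀ s₁ s₂ y := fun h =>
  hG.notMem ((A.mul_mem_cancel_left (word_mem h0 h1 h2 x)).1 (h ▸ word_mem h0 h1 h2 y))

lemma eq_of_forall_word {D C : Set G}
    (hgen : ∀ g, ∃ x, g = word s₀ s₁ s₂ x ∨ g = word s₀ s₁ s₂ x * t)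
    (hP : ∀ x, word s₀ s₁ s₂ x * t ∈ D ↔ word s₀ s₁ s₂ x * t ∈ C)
    (hQ : ∀ x, word s₀ s₁ s₂ x ∈ D ↔ word s₀ s₁ s₂ x ∈ C) : D = C := by
  ext g
  obtain ⟨x, rfl | rfl⟩ := hgen g
  exacts [hQ x, hP x]

/-- The relations between the generators respect a code given by a linear form. -/
lemma RelationsVanish.of_code {D : Set G} {a b : ℤ}
    (hP : ∀ x, word s₀ s₁ s₂ x * t ∈ D ↔ 5 ∣ x.1 - a * x.2.1 - b * x.2.2) :
    RelationsVanish s₀ s₁ s₂ a b := by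
  intro x hx
  rw [← hP, hx, ← word_zero (s₀ := s₀) (s₁ := s₁) (s₂ := s₂), hP]
  simp

/-- As the form is well defined mod 5 on group elements, membership can be tested on any exponent
vector. The explicit union lists reduced vectors on which the form is 0 (with `t`) or `v` (without
`t`) mod 5. -/
lemma mem_codeTwo_iff [Finite G] (hG : IsGeneralizedDihedral A t) (h0 : s₀ ∈ A)
    (h1 : s₁ ∈ A) (h2 : s₂ ∈ A) {m l v : ℕ}
    (hm : IsLeast {i : ℕ | 0 < i ∧ s₁ ^ i ∈ Subgroup.zpowers s₀} m)
    (hl : IsLeast {i : ℕ | 0 < i ∧ s₂ ^ i ∈ Subgroup.closure {s₀, s₁}} l) {a b : ℤ}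
    (h : RelationsVanish s₀ s₁ s₂ a b) (x : ℤ × ℤ × ℤ) :
    (word s₀ s₁ s₂ x * t ∈ codeTwo t s₀ s₁ s₂ m l v a b ↔ 5 ∣ x.1 - a * x.2.1 - b * x.2.2) ∧
    (word s₀ s₁ s₂ x ∈ codeTwo t s₀ s₁ s₂ m l v a b ↔
      5 ∣ x.1 - a * x.2.1 - b * x.2.2 - v) := by
  have c01 := hG.commute h0 h1
  have c02 := hG.commute h0 h2
  have c12 := hG.commute h1 h2
  have mem_iff : ∀ g, g ∈ codeTwo t s₀ s₁ s₂ m l v a b ↔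
      ∃ α < orderOf s₀ / 5, ∃ j < m, ∃ k < l,
        g = word s₀ s₁ s₂ (5 * (α : ℤ) + a * j + b * k, (j : ℤ), (k : ℤ)) * t ∨
        g = word s₀ s₁ s₂ (5 * (α : ℤ) + a * j + b * k + v, (j : ℤ), (k : ℤ)) := by
    intro g
    simp [codeTwo, word, or_comm]
  simp only [mem_iff]
  constructor
  · constructor
    · rintro ⟨α, -, j, -, k, -, e | e⟩
      · obtain ⟨d, hd⟩ := h.congr c01 c02 c12 (mul_right_cancel e)
        exact ⟨d + α, by simp only at hd; linear_combination hd⟩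
      · exact absurd e (hG.word_ne h0 h1 h2 _ _)
    · intro hx
      obtain ⟨α, hα, j, hj, k, hk, e⟩ :=
        exists_codeTwo_word c01 c02 c12 hm hl h 0 (by simpa using hx)
      exact ⟨α, hα, j, hj, k, hk, .inl (by rw [e, add_zero])⟩
  · constructor
    · rintro ⟨α, -, j, -, k, -, e | e⟩
      · exact absurd e.symm (hG.word_ne h0 h1 h2 _ _)
      · obtain ⟨d, hd⟩ := h.congr c01 c02 c12 e
        exact ⟨d + α, by simp only at hd; linear_combination hd⟩
    · intro hx
      obtain ⟨α, hα, j, hj, k, hk, e⟩ := exists_codeTwo_word c01 c02 c12 hm hl h v hx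
      exact ⟨α, hα, j, hj, k, hk, .inr e⟩

end Dihedral

/-! ### Connection sets outside `A`. -/

section Bipartite

variable {G : Type*} [Group G] {A : Subgroup G} {t s₀ s₁ s₂ : G} {S : Set G}

lemma exists_word_of_bipartite (hG : IsGeneralizedDihedral A t) (hS : IsQuarticConnectionSet S)
    (h0 : s₀ ∈ A) (h1 : s₁ ∈ A) (h2 : s₂ ∈ A)
    (hc : S = Set.range fun i => t * word s₀ s₁ s₂ (latticeStep i)) (g : G) :
    ∃ x, g = word s₀ s₁ s₂ x ∨ g = word s₀ s₁ s₂ x * t := by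
  induction g using hS.induction with
  | h1 => exact ⟨0, .inl word_zero.symm⟩
  | hmul g ih s hs =>
    rw [hc] at hs
    obtain ⟨i, rfl⟩ := hs
    obtain ⟨x, rfl | rfl⟩ := ih
    · exact ⟨_, .inr (hG.word_mul_t_word h0 h1 h2 _ _)⟩
    · exact ⟨_, .inl (hG.word_t_mul_t_word h0 h1 h2 _ _)⟩

/-- Right multiplication by the generators shifts exponent vectors by `+ latticeStep i` on the coset
with `t` and by `- latticeStep i` on `A`, so neighbourhoods correspond one to one. -/
lemma isPerfectCode_iff_isBipartiteCode (hG : IsGeneralizedDihedral A t)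
    (hS : IsQuarticConnectionSet S) (h0 : s₀ ∈ A) (h1 : s₁ ∈ A) (h2 : s₂ ∈ A)
    (hc : S = Set.range fun i => t * word s₀ s₁ s₂ (latticeStep i)) (D : Set G) :
    IsPerfectCode (SimpleGraph.mulCayley S) D ↔
      IsBipartiteCode latticeStep (fun x => word s₀ s₁ s₂ x * t ∈ D)
        (fun x => word s₀ s₁ s₂ x ∈ D) := by
  rw [isPerfectCode_iff hS hc]
  constructor
  · intro h
    have hw := fun x => h (word s₀ s₁ s₂ x)
    have hwt := fun x => h (word s₀ s₁ s₂ x * t)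
    simp only [hG.word_mul_t_word h0 h1 h2] at hw
    simp only [hG.word_t_mul_t_word h0 h1 h2] at hwt
    exact ⟨fun x => (hwt x).1, fun x => (hw x).1, fun x => (hwt x).2.2, fun x => (hw x).2.2,
      fun x i => (hwt x).2.1 i⟩
  · intro h g
    obtain ⟨x, rfl | rfl⟩ := exists_word_of_bipartite hG hS h0 h1 h2 hc g
    · simp only [hG.word_mul_t_word h0 h1 h2]
      exact ⟨h.cover_right x, fun i hx hi => h.disjoint _ i hi (by simpa using hx),
        h.unique_right x⟩
    · simp only [hG.word_t_mul_t_word h0 h1 h2]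
      exact ⟨h.cover_left x, fun i => h.disjoint x i, h.unique_left x⟩

theorem isPerfectCode_bipartite_iff [Finite G] (hG : IsGeneralizedDihedral A t)
    (hS : IsQuarticConnectionSet S) (h0 : s₀ ∈ A) (h1 : s₁ ∈ A) (h2 : s₂ ∈ A)
    (hc : S = {t, t * s₀, t * s₁, t * s₂}) {m l : ℕ}
    (hm : IsLeast {i : ℕ | 0 < i ∧ s₁ ^ i ∈ Subgroup.zpowers s₀} m)
    (hl : IsLeast {i : ℕ | 0 < i ∧ s₂ ^ i ∈ Subgroup.closure {s₀, s₁}} l) (D : Set G) :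
    (IsPerfectCode (SimpleGraph.mulCayley S) D ∧ t ∈ D) ↔
      ∃ (v : ℕ) (a b : ℤ), AdmissibleTriple v a b ∧ ConditionTwo s₀ s₁ s₂ m l a b ∧
        D = codeTwo t s₀ s₁ s₂ m l v a b := by
  have hc' : S = Set.range fun i => t * word s₀ s₁ s₂ (latticeStep i) := by
    rw [hc]
    ext
    simp [Fin.exists_fin_succ, latticeStep, word, eq_comm]
  simp only [conditionTwo_iff_relationsVanish (hG.commute h0 h1) (hG.commute h0 h2)
    (hG.commute h1 h2) hm hl, isPerfectCode_iff_isBipartiteCode hG hS h0 h1 h2 hc']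
  have ht0 : word s₀ s₁ s₂ 0 * t = t := by rw [word_zero, one_mul]
  constructor
  · rintro ⟨h, ht⟩
    obtain ⟨v, a, b, hv, hP, hQ⟩ := h.exists_admissibleTriple (by rwa [ht0])
    have hrel : RelationsVanish s₀ s₁ s₂ a b := .of_code hP
    refine ⟨v, a, b, hv, hrel, ?_⟩
    have hmem := mem_codeTwo_iff (v := v) hG h0 h1 h2 hm hl hrel
    exact eq_of_forall_word (exists_word_of_bipartite hG hS h0 h1 h2 hc')
      (fun x => (hP x).trans (hmem x).1.symm) (fun x => (hQ x).trans (hmem x).2.symm)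
  · rintro ⟨v, a, b, hv, hrel, rfl⟩
    have hmem := mem_codeTwo_iff (v := v) hG h0 h1 h2 hm hl hrel
    refine ⟨?_, ?_⟩
    · simp only [fun x => (hmem x).1, fun x => (hmem x).2]
      exact .of_linear hv
    · have := (hmem 0).1
      rw [ht0] at this
      simp [this]

end Bipartite

/-! ### Connection sets meeting `A` in an inverse pair. -/

section Grid

variable {G : Type*} [Group G] {A : Subgroup G} {t s₀ s₁ : G} {S : Set G}

/-- The vertices `s₀ ^ i * s₁ ^ q` and `s₀ ^ i * s₁ ^ q * t`, at `(2 i, q)` and `(2 i + 1, q)`. -/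
def gridPoint (t s₀ s₁ : G) (p q : ℤ) : G :=
  if p % 2 = 0 then word s₀ s₁ 1 (p / 2, q, 0) else word s₀ s₁ 1 (p / 2, q, 0) * t

lemma gridPoint_two_mul (i q : ℤ) : gridPoint t s₀ s₁ (2 * i) q = word s₀ s₁ 1 (i, q, 0) := by
  simp [gridPoint]

lemma gridPoint_two_mul_add_one (i q : ℤ) :
    gridPoint t s₀ s₁ (2 * i + 1) q = word s₀ s₁ 1 (i, q, 0) * t := by
  have h1 : (2 * i + 1) % 2 ≠ 0 := by omega
  have h2 : (2 * i + 1) / 2 = i := by omega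
  rw [gridPoint, if_neg h1, h2]

lemma word_one_eq (x : ℤ × ℤ × ℤ) : word s₀ s₁ 1 x = word s₀ s₁ 1 (x.1, x.2.1, 0) := by
  simp [word]

lemma isPerfectCode_iff_isGridCode (hG : IsGeneralizedDihedral A t)
    (hS : IsQuarticConnectionSet S) (h0 : s₀ ∈ A) (h1 : s₁ ∈ A)
    (hc : S = {s₁, s₁⁻¹, t, t * s₀}) (D : Set G) :
    (∀ g, ∃ x, g = word s₀ s₁ 1 x ∨ g = word s₀ s₁ 1 x * t) ∧
    (IsPerfectCode (SimpleGraph.mulCayley S) D ↔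
      IsGridCode fun p q => gridPoint t s₀ s₁ p q ∈ D) := by
  have h2 : (1 : G) ∈ A := one_mem A
  have w1 : s₁ = word s₀ s₁ 1 (0, 1, 0) := by simp [word]
  have w1' : s₁⁻¹ = word s₀ s₁ 1 (0, -1, 0) := by simp [word]
  have wt0 : t * s₀ = t * word s₀ s₁ 1 (1, 0, 0) := by simp [word]
  have e1 : ∀ i q, word s₀ s₁ 1 (i, q, 0) * s₁ = word s₀ s₁ 1 (i, q + 1, 0) := by
    intro i q
    nth_rw 2 [w1]
    simp [← hG.word_add h0 h1 h2]
  have e2 : ∀ i q, word s₀ s₁ 1 (i, q, 0) * s₁⁻¹ = word s₀ s₁ 1 (i, q - 1, 0) := by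
    intro i q
    rw [w1', ← hG.word_add h0 h1 h2]
    simp [sub_eq_add_neg]
  have e3 : ∀ i q, word s₀ s₁ 1 (i, q, 0) * (t * s₀) = word s₀ s₁ 1 (i - 1, q, 0) * t := by
    intro i q
    rw [wt0, hG.word_mul_t_word h0 h1 h2]
    simp
  have f1 : ∀ i q, word s₀ s₁ 1 (i, q, 0) * t * s₁ = word s₀ s₁ 1 (i, q - 1, 0) * t := by
    intro i q
    rw [mul_assoc, hG.mul_comm h1, ← mul_assoc, e2]
  have f2 : ∀ i q, word s₀ s₁ 1 (i, q, 0) * t * s₁⁻¹ = word s₀ s₁ 1 (i, q + 1, 0) * t := by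
    intro i q
    rw [mul_assoc, hG.mul_comm (inv_mem h1), inv_inv, ← mul_assoc, e1]
  have f3 : ∀ i q, word s₀ s₁ 1 (i, q, 0) * t * t = word s₀ s₁ 1 (i, q, 0) := by
    intro i q
    rw [mul_assoc, hG.mul_self, mul_one]
  have f4 : ∀ i q, word s₀ s₁ 1 (i, q, 0) * t * (t * s₀) = word s₀ s₁ 1 (i + 1, q, 0) := by
    intro i q
    rw [wt0, hG.word_t_mul_t_word h0 h1 h2]
    simp
  have hgen : ∀ g, ∃ i q, g = word s₀ s₁ 1 (i, q, 0) ∨ g = word s₀ s₁ 1 (i, q, 0) * t := by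
    intro g
    induction g using hS.induction with
    | h1 => exact ⟨0, 0, .inl word_zero.symm⟩
    | hmul g ih s hs =>
      rw [hc] at hs
      obtain ⟨i, q, rfl | rfl⟩ := ih <;> rcases hs with rfl | rfl | rfl | rfl
      · exact ⟨_, _, .inl (e1 i q)⟩
      · exact ⟨_, _, .inl (e2 i q)⟩
      · exact ⟨_, _, .inr rfl⟩
      · exact ⟨_, _, .inr (e3 i q)⟩
      · exact ⟨_, _, .inr (f1 i q)⟩
      · exact ⟨_, _, .inr (f2 i q)⟩
      · exact ⟨_, _, .inl (f3 i q)⟩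
      · exact ⟨_, _, .inl (f4 i q)⟩
  refine ⟨fun g => ?_, ?_⟩
  · obtain ⟨i, q, h⟩ := hgen g
    exact ⟨_, h⟩
  have even : ∀ i q : ℤ,
      ExactlyOneOfFive (gridPoint t s₀ s₁ (2 * i) q ∈ D) (gridPoint t s₀ s₁ (2 * i) (q + 1) ∈ D)
        (gridPoint t s₀ s₁ (2 * i) (q - 1) ∈ D) (gridPoint t s₀ s₁ (2 * i + 1) q ∈ D)
        (gridPoint t s₀ s₁ (2 * i - 1) q ∈ D) ↔
      ExactlyOneOfFive (word s₀ s₁ 1 (i, q, 0) ∈ D) (word s₀ s₁ 1 (i, q, 0) * s₁ ∈ D)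
        (word s₀ s₁ 1 (i, q, 0) * s₁⁻¹ ∈ D) (word s₀ s₁ 1 (i, q, 0) * t ∈ D)
        (word s₀ s₁ 1 (i, q, 0) * (t * s₀) ∈ D) := by
    intro i q
    rw [e1, e2, e3, show 2 * i - 1 = 2 * (i - 1) + 1 by ring]
    simp only [gridPoint_two_mul, gridPoint_two_mul_add_one]
  have odd : ∀ i q : ℤ,
      ExactlyOneOfFive (gridPoint t s₀ s₁ (2 * i + 1) q ∈ D)
        (gridPoint t s₀ s₁ (2 * i + 1) (q + 1) ∈ D) (gridPoint t s₀ s₁ (2 * i + 1) (q - 1) ∈ D)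
        (gridPoint t s₀ s₁ (2 * i + 1 + 1) q ∈ D) (gridPoint t s₀ s₁ (2 * i + 1 - 1) q ∈ D) ↔
      ExactlyOneOfFive (word s₀ s₁ 1 (i, q, 0) * t ∈ D) (word s₀ s₁ 1 (i, q, 0) * t * s₁ ∈ D)
        (word s₀ s₁ 1 (i, q, 0) * t * s₁⁻¹ ∈ D) (word s₀ s₁ 1 (i, q, 0) * t * t ∈ D)
        (word s₀ s₁ 1 (i, q, 0) * t * (t * s₀) ∈ D) := by
    intro i q
    -- Since `t` inverts `A`, the generators `s₁` and `s₁⁻¹` move in the opposite directions on the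
    -- odd columns, as do `t` and `t * s₀`; `ExactlyOneOfFive.swap` absorbs this.
    rw [f1, f2, f3, f4, show 2 * i + 1 + 1 = 2 * (i + 1) by ring,
      show 2 * i + 1 - 1 = 2 * i by ring,
      ExactlyOneOfFive.swap]
    simp only [gridPoint_two_mul, gridPoint_two_mul_add_one]
  rw [isPerfectCode_iff_exactlyOneOfFive hS hc]
  constructor
  · intro h p q
    rcases Int.even_or_odd' p with ⟨i, rfl | rfl⟩
    · exact (even i q).2 (h _)
    · exact (odd i q).2 (h _)
  · intro h g
    obtain ⟨i, q, rfl | rfl⟩ := hgen g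
    · exact (even i q).1 (h _ _)
    · exact (odd i q).1 (h _ _)

/-- Taking `s₂ = 1`, `l = 1`, `a = ε`, `b = 0` makes the relation criterion and the explicit codes
of the three-generator setting available for the grid. -/
lemma conditionTwo_one_iff {m : ℕ} (hm : 0 < m) {ε : ℤ} :
    ConditionTwo s₀ s₁ 1 m 1 ε 0 ↔ ConditionOne s₀ s₁ m (-ε) := by
  constructor
  · rintro ⟨h5, w, hw, -, -, -, -, h, -⟩
    exact ⟨h5, w, hw, by rw [h]; congr 1; ring⟩
  · rintro ⟨h5, w, hw, h⟩
    exact ⟨h5, w, hw, 0, by omega, 0, hm, by rw [h]; congr 1; ring, by simp⟩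

lemma codeTwo_one_eq {m : ℕ} {ε : ℤ} :
    codeTwo t s₀ s₁ 1 m 1 3 ε 0 = codeOne t s₀ s₁ m ε := by
  ext g
  simp only [codeTwo, codeOne, Set.mem_iUnion, Finset.mem_range, exists_prop, Set.mem_union,
    Set.mem_singleton_iff, Set.mem_insert_iff]
  have e : ∀ (w k : ℕ), 5 * (w : ℤ) + ε * k + 3 = 3 + 5 * w + ε * k := fun w k => by ring
  constructor
  · rintro ⟨w, hw, k, hk, z, -, h⟩
    exact ⟨k, hk, w, hw, by simpa [e] using h⟩
  · rintro ⟨k, hk, w, hw, h⟩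
    exact ⟨w, hw, k, hk, 0, by simp, by simpa [e] using h⟩

theorem isPerfectCode_grid_iff [Finite G] (hG : IsGeneralizedDihedral A t)
    (hS : IsQuarticConnectionSet S) (h0 : s₀ ∈ A) (h1 : s₁ ∈ A)
    (hc : S = {s₁, s₁⁻¹, t, t * s₀}) {m : ℕ}
    (hm : IsLeast {i : ℕ | 0 < i ∧ s₁ ^ i ∈ Subgroup.zpowers s₀} m) (D : Set G) :
    (IsPerfectCode (SimpleGraph.mulCayley S) D ∧ t ∈ D) ↔
      ∃ ε ∈ ({1, -1} : Set ℤ), ConditionOne s₀ s₁ m (-ε) ∧ D = codeOne t s₀ s₁ m ε := by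
  have h2 : (1 : G) ∈ A := one_mem A
  have hl : IsLeast {i : ℕ | 0 < i ∧ (1 : G) ^ i ∈ Subgroup.closure {s₀, s₁}} 1 :=
    ⟨⟨one_pos, by simp [one_mem]⟩, fun i hi => hi.1⟩
  simp only [← conditionTwo_one_iff hm.1.1, ← codeTwo_one_eq,
    conditionTwo_iff_relationsVanish (hG.commute h0 h1) (hG.commute h0 h2) (hG.commute h1 h2) hm hl]
  obtain ⟨hgen, hgrid⟩ := isPerfectCode_iff_isGridCode hG hS h0 h1 hc D
  have hpt : gridPoint t s₀ s₁ 1 0 = t := by simp [gridPoint, word]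
  constructor
  · rintro ⟨h, ht⟩
    obtain ⟨δ, hδ, hR⟩ := (hgrid.1 h).exists_linear (by rwa [hpt])
    have hP : ∀ x, word s₀ s₁ 1 x * t ∈ D ↔ 5 ∣ x.1 - -δ * x.2.1 - 0 * x.2.2 := by
      intro x
      rw [word_one_eq, ← gridPoint_two_mul_add_one, hR]
      rcases hδ with rfl | rfl <;> omega
    -- Even columns give `2i - 1 + 2δq`; multiplying by 3, the inverse of 2 mod 5, turns this into
    -- `i + δq - 3`, whence `v = 3`.
    have hQ : ∀ x, word s₀ s₁ 1 x ∈ D ↔ 5 ∣ x.1 - -δ * x.2.1 - 0 * x.2.2 - (3 : ℕ) := by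
      intro x
      rw [word_one_eq, ← gridPoint_two_mul (t := t), hR]
      rcases hδ with rfl | rfl <;> omega
    have hrel : RelationsVanish s₀ s₁ 1 (-δ) 0 := .of_code hP
    have hmem := mem_codeTwo_iff (v := 3) hG h0 h1 h2 hm hl hrel
    refine ⟨-δ, by rcases hδ with rfl | rfl <;> simp, hrel, ?_⟩
    exact eq_of_forall_word hgen (fun x => (hP x).trans (hmem x).1.symm)
      (fun x => (hQ x).trans (hmem x).2.symm)
  · rintro ⟨ε, hε, hrel, rfl⟩
    have hmem := mem_codeTwo_iff (v := 3) hG h0 h1 h2 hm hl hrel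
    have hε' : ε = 1 ∨ ε = -1 := hε
    refine ⟨hgrid.2 ?_, ?_⟩
    · have : (fun p q => gridPoint t s₀ s₁ p q ∈ codeTwo t s₀ s₁ 1 m 1 3 ε 0) =
          fun p q => 5 ∣ p - 1 + 2 * -ε * q := by
        funext p q
        apply propext
        rcases Int.even_or_odd' p with ⟨i, rfl | rfl⟩
        · rw [gridPoint_two_mul, (hmem _).2]
          rcases hε' with rfl | rfl <;> push_cast <;> omega
        · rw [gridPoint_two_mul_add_one, (hmem _).1]
          rcases hε' with rfl | rfl <;> push_cast <;> omega
      rw [this]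
      exact .of_linear (by omega)
    · have := (hmem 0).1
      rw [word_zero, one_mul] at this
      rw [this]
      simp

end Grid

theorem theorem1p2 {G : Type*} [Group G] [Finite G] (A : Subgroup G) (t : G)
    (hG : IsGeneralizedDihedral A t) (S : Set G) (hS : IsQuarticConnectionSet S) (ht : t ∈ S)
    (hcode : ∃ D : Set G, IsPerfectCode (SimpleGraph.mulCayley S) D) :
    (∀ (s₀ s₁ : G) (m : ℕ), s₀ ∈ A → s₁ ∈ A →
      S = {s₁, s₁⁻¹, t, t * s₀} →
      IsLeast {i : ℕ | 0 < i ∧ s₁ ^ i ∈ Subgroup.zpowers s₀} m →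
      (∃ δ ∈ ({1, -1} : Set ℤ), ConditionOne s₀ s₁ m δ) →
      ∀ D : Set G, (IsPerfectCode (SimpleGraph.mulCayley S) D ∧ t ∈ D) ↔
        ∃ ε ∈ ({1, -1} : Set ℤ), ConditionOne s₀ s₁ m (-ε) ∧ D = codeOne t s₀ s₁ m ε) ∧
    (∀ (s₀ s₁ s₂ : G) (m l : ℕ), s₀ ∈ A → s₁ ∈ A → s₂ ∈ A →
      S = {t, t * s₀, t * s₁, t * s₂} →
      IsLeast {i : ℕ | 0 < i ∧ s₁ ^ i ∈ Subgroup.zpowers s₀} m →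
      IsLeast {i : ℕ | 0 < i ∧ s₂ ^ i ∈ Subgroup.closure {s₀, s₁}} l →
      (∃ (v : ℕ) (a b : ℤ), AdmissibleTriple v a b ∧ ConditionTwo s₀ s₁ s₂ m l a b) →
      ∀ D : Set G, (IsPerfectCode (SimpleGraph.mulCayley S) D ∧ t ∈ D) ↔
        ∃ (v : ℕ) (a b : ℤ), AdmissibleTriple v a b ∧ ConditionTwo s₀ s₁ s₂ m l a b ∧
          D = codeTwo t s₀ s₁ s₂ m l v a b) := by
  refine ⟨fun s₀ s₁ m h0 h1 hc hm _ D => isPerfectCode_grid_iff hG hS h0 h1 hc hm D,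
    fun s₀ s₁ s₂ m l h0 h1 h2 hc hm hl _ D => isPerfectCode_bipartite_iff hG hS h0 h1 h2 hc hm hl D⟩
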